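/- Let $(M,g)$ be a compact, connected, two-dimensional smooth Riemannian manifold without boundary, with Riemannian area measure $\mu$ and Laplace–Beltrami operator $\Delta=\operatorname{div}\nabla$. Let $f:M\to\mathbb R$ be a smooth, not identically zero function with $-\Delta f=\lambda f$ on $M$, and assume that $f$ is a Morse function, i.e. that its Hessian is nondegenerate at every critical point. Let $\varphi(t,x)$ be the flow of $-\nabla f$, and for a critical point $c$ let $W^s(c)=\{y:\lim_{t\to\infty}\varphi(t,y)=c\}$ and $W^u(c)=\{y:\lim_{t\to-\infty}\varphi(t,y)=c\}$. Let $\Omega$ be a Neumann domain of $f$, i.e. a connected component of $W^s(p)\cap W^u(q)$ for some local minimum $p$ and some local maximum $q$ of $f$. Then: 1. $f|_\Omega$ is an eigenfunction with eigenvalue $\lambda$ of the Neumann Laplacian of $\Omega$ (the self-adjoint operator associated with the form $\int_\Omega g(\nabla u,\nabla v)\,d\mu$ on the Sobolev space $H^1(\Omega)$): $f|_\Omega$ is a nonzero element of $H^1(\Omega)$, and $$\int_\Omega g(\nabla f,\nabla v)\,d\mu=\lambda\int_\Omega f\,v\,d\mu\qquad\text{for all }v\in H^1(\Omega).$$ 2.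 The normal derivative of $f$ vanishes on $\partial\Omega$: if $x\in\partial\Omega$ and $h$ is a real function on $M$, differentiable at $x$, that vanishes on $\partial\Omega$ near $x$, then $g(\nabla h,\nabla f)(x)=0$. (In particular $\hat n\cdot\nabla f=0$ wherever $\partial\Omega$ is a $C^1$ curve with unit normal $\hat n$.) -/

import Mathlib

open Set Filter MeasureTheory
open scoped Manifold ContDiff Topology

namespace NeumannDomains

/-- The model plane with its Euclidean norm and Lebesgue measure. -/
abbrev Plane : Type := EuclideanSpace ℝ (Fin 2)

section Metric

variable {M : Type*} [TopologicalSpace M] [ChartedSpace Plane M] [IsManifold (𝓡 2) ∞ M]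

/-- A smooth Riemannian metric on the surface `M`. -/
abbrev Metric (M : Type*) [TopologicalSpace M] [ChartedSpace Plane M]
    [IsManifold (𝓡 2) ∞ M] : Type _ :=
  Bundle.ContMDiffRiemannianMetric (𝓡 2) ∞ Plane (fun x : M => TangentSpace (𝓡 2) x)

/-- A (not necessarily continuous) vector field on `M`. -/
abbrev VField (M : Type*) [TopologicalSpace M] [ChartedSpace Plane M] : Type _ :=
  (x : M) → TangentSpace (𝓡 2) x

/-- Every covector is represented by a tangent vector through the metric. -/
theorem exists_sharp (g : Metric M) (x : M) (l : TangentSpace (𝓡 2) x →L[ℝ] ℝ) :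
    ∃ v : TangentSpace (𝓡 2) x, ∀ w, g.inner x v w = l w := by
  have : FiniteDimensional ℝ (TangentSpace (𝓡 2) x) :=
    inferInstanceAs (FiniteDimensional ℝ Plane)
  let B : TangentSpace (𝓡 2) x →ₗ[ℝ] Module.Dual ℝ (TangentSpace (𝓡 2) x) :=
    { toFun := fun v => (g.inner x v).toLinearMap
      map_add' := fun v w => by ext; simp
      map_smul' := fun c v => by ext; simp }
  have hinj : Function.Injective B := by
    rw [injective_iff_map_eq_zero]
    intro v hv
    by_contra hne
    have h1 : g.inner x v v = 0 := LinearMap.congr_fun hv v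
    exact (g.pos x v hne).ne' h1
  have hsurj : Function.Surjective B :=
    (LinearMap.injective_iff_surjective_of_finrank_eq_finrank
      (Subspace.dual_finrank_eq).symm).1 hinj
  obtain ⟨v, hv⟩ := hsurj l.toLinearMap
  exact ⟨v, fun w => LinearMap.congr_fun hv w⟩

/-- The Riemannian gradient: `g (∇f, w) = df(w)` for every tangent vector `w`. -/
noncomputable def grad (g : Metric M) (f : M → ℝ) : VField M :=
  fun x => Classical.choose (exists_sharp g x (mfderiv (𝓡 2) 𝓘(ℝ, ℝ) f x))

theorem inner_grad (g : Metric M) (f : M → ℝ) (x : M) (w : TangentSpace (𝓡 2) x) :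
    g.inner x (grad g f x) w = mfderiv (𝓡 2) 𝓘(ℝ, ℝ) f x w :=
  Classical.choose_spec (exists_sharp g x (mfderiv (𝓡 2) 𝓘(ℝ, ℝ) f x)) w

/-- The coordinate vector field `∂_i` of the chart centred at `c`, at the point with
coordinates `y`. -/
noncomputable def coordVec (c : M) (y : Plane) (i : Fin 2) :
    TangentSpace (𝓡 2) ((chartAt Plane c).symm y) :=
  mfderiv (𝓡 2) (𝓡 2) (chartAt Plane c).symm y (EuclideanSpace.single i (1 : ℝ) : Plane)

/-- The matrix `g_ij = g(∂_i, ∂_j)` of the metric in the chart centred at `c`. -/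
noncomputable def gram (g : Metric M) (c : M) (y : Plane) : Matrix (Fin 2) (Fin 2) ℝ :=
  Matrix.of fun i j => g.inner ((chartAt Plane c).symm y) (coordVec c y i) (coordVec c y j)

/-- The density `√(det g_ij)` of the Riemannian area in the chart centred at `c`. -/
noncomputable def density (g : Metric M) (c : M) (y : Plane) : ℝ :=
  Real.sqrt (gram g c y).det

/-- The components `(X^1, X^2)` at `x` of a vector field in the chart centred at `c`. -/
noncomputable def components (c : M) (X : VField M) (x : M) : Plane :=
  mfderiv (𝓡 2) (𝓡 2) (chartAt Plane c) x (X x)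

/-- The Riemannian divergence `(1/√det g) ∑ i, ∂_i (√det g X^i)`, computed at `x` in the
chart centred at `x`. -/
noncomputable def divergence (g : Metric M) (X : VField M) (x : M) : ℝ :=
  (density g x (chartAt Plane x x))⁻¹ *
    ∑ i : Fin 2, fderiv ℝ
      (fun y : Plane => density g x y * components x X ((chartAt Plane x).symm y) i)
      (chartAt Plane x x) (EuclideanSpace.single i (1 : ℝ))

/-- The Laplace-Beltrami operator `Δ = div ∇`. -/
noncomputable def laplaceBeltrami (g : Metric M) (f : M → ℝ) : M → ℝ :=
  divergence g (grad g f)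

/-- `f` is an eigenfunction: smooth, not identically zero, and `-Δ f = lam f`. -/
structure IsLaplaceEigenfunction (g : Metric M) (f : M → ℝ) (lam : ℝ) : Prop where
  smooth : ContMDiff (𝓡 2) 𝓘(ℝ, ℝ) ∞ f
  ne_zero : f ≠ 0
  eigen : ∀ x, -laplaceBeltrami g f x = lam * f x

end Metric

section Morse

variable {M : Type*} [TopologicalSpace M] [ChartedSpace Plane M] [IsManifold (𝓡 2) ∞ M]

/-- The Hessian of `f` at `x` in the chart centred at `x`. -/
noncomputable def hessian (f : M → ℝ) (x : M) : Plane →L[ℝ] Plane →L[ℝ] ℝ :=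
  fderiv ℝ (fderiv ℝ (f ∘ (chartAt Plane x).symm)) (chartAt Plane x x)

/-- `f` is a Morse function: smooth, and the Hessian is nondegenerate at each critical point. -/
structure IsMorse (f : M → ℝ) : Prop where
  smooth : ContMDiff (𝓡 2) 𝓘(ℝ, ℝ) ∞ f
  nondegenerate : ∀ x, mfderiv (𝓡 2) 𝓘(ℝ, ℝ) f x = 0 →
    ∀ v, (∀ w, hessian f x v w = 0) → v = 0

/-- `γ` is the flow line `t ↦ φ(t, y)` of `-∇f` that starts at `y`. -/
def IsFlowLine (g : Metric M) (f : M → ℝ) (γ : ℝ → M) (y : M) : Prop :=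
  γ 0 = y ∧ IsMIntegralCurve γ (fun x => -grad g f x : VField M)

/-- The stable manifold `{y | φ(t, y) → x as t → ∞}`. -/
def stableManifold (g : Metric M) (f : M → ℝ) (x : M) : Set M :=
  {y | ∃ γ : ℝ → M, IsFlowLine g f γ y ∧ Tendsto γ atTop (𝓝 x)}

/-- The unstable manifold `{y | φ(t, y) → x as t → -∞}`. -/
def unstableManifold (g : Metric M) (f : M → ℝ) (x : M) : Set M :=
  {y | ∃ γ : ℝ → M, IsFlowLine g f γ y ∧ Tendsto γ atBot (𝓝 x)}

/-- `Ω` is a Neumann domain of `f`: a connected component of `W^s(p) ∩ W^u(q)` for a (local)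
minimum `p` and a (local) maximum `q`. -/
def IsNeumannDomain (g : Metric M) (f : M → ℝ) (Ω : Set M) : Prop :=
  ∃ p q : M, IsLocalMin f p ∧ IsLocalMax f q ∧
    ∃ y ∈ stableManifold g f p ∩ unstableManifold g f q,
      Ω = connectedComponentIn (stableManifold g f p ∩ unstableManifold g f q) y

end Morse

section Volume

theorem exists_chart_cover (M : Type*) [TopologicalSpace M] [ChartedSpace Plane M]
    [CompactSpace M] [Nonempty M] :
    ∃ c : ℕ → M, ⋃ n, (chartAt Plane (c n)).source = univ := by
  obtain ⟨s, hs, hu⟩ := countable_cover_nhds_of_sigmaCompact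
    fun x : M => chart_source_mem_nhds Plane x
  have hne : s.Nonempty := by
    by_contra h
    rw [not_nonempty_iff_eq_empty] at h
    subst h
    simp only [mem_empty_iff_false, iUnion_of_empty, iUnion_empty] at hu
    exact empty_ne_univ hu
  obtain ⟨c, rfl⟩ := hs.exists_eq_range hne
  exact ⟨c, by simpa using hu⟩

variable {M : Type*} [TopologicalSpace M] [ChartedSpace Plane M] [IsManifold (𝓡 2) ∞ M]
  [CompactSpace M] [Nonempty M] [MeasurableSpace M]

/-- The Riemannian area on the domain of the chart centred at `c`: the image of
`√(det g_ij) dy` under the inverse chart. -/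
noncomputable def chartVolume (g : Metric M) (c : M) : Measure M :=
  Measure.map (chartAt Plane c).symm
    (((volume : Measure Plane).restrict (chartAt Plane c).target).withDensity
      fun y => ENNReal.ofReal (density g c y))

/-- The Riemannian area measure, glued from the charts of a countable cover along a partition
of `M` into sets that lie in one chart domain each (the result does not depend on the cover). -/
noncomputable def riemannianVolume (g : Metric M) : Measure M :=
  let c := Classical.choose (exists_chart_cover M)
  Measure.sum fun n => (chartVolume g (c n)).restrict
    (disjointed (fun k => (chartAt Plane (c k)).source) n)

end Volume

section Neumann

variable {M : Type*} [TopologicalSpace M] [ChartedSpace Plane M] [IsManifold (𝓡 2) ∞ M]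
  [CompactSpace M] [Nonempty M] [MeasurableSpace M]

/-- `X` is a continuously differentiable vector field with compact support in `Ω`. -/
def IsTestField (Ω : Set M) (X : VField M) : Prop :=
  ContMDiff (𝓡 2) (𝓡 2).tangent 1 (fun x => (⟨x, X x⟩ : TangentBundle (𝓡 2) M)) ∧
    ∃ K ⊆ Ω, IsCompact K ∧ ∀ x ∉ K, X x = 0

/-- `u` belongs to the Sobolev space `H¹(Ω)` of the open set `Ω` with weak gradient `V`: both are
square integrable on `Ω` (`V` being measurable in charts), and `∫_Ω u div X = -∫_Ω g(V, X)` for all test fields `X`. The values of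
`u` and `V` outside `Ω` are irrelevant. -/
structure IsSobolev (g : Metric M) (Ω : Set M) (u : M → ℝ) (V : VField M) : Prop where
  memLp : MemLp u 2 ((riemannianVolume g).restrict Ω)
  aestronglyMeasurable : ∀ c : M, AEStronglyMeasurable (components c V)
    ((riemannianVolume g).restrict (Ω ∩ (chartAt Plane c).source))
  integrable_sq : Integrable (fun x => g.inner x (V x) (V x)) ((riemannianVolume g).restrict Ω)
  weak_grad : ∀ X : VField M, IsTestField Ω X →
    ∫ x in Ω, u x * divergence g X x ∂(riemannianVolume g) =
      -∫ x in Ω, g.inner x (V x) (X x) ∂(riemannianVolume g)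

/-- The restriction of `u` to the open set `Ω` is an eigenfunction, with eigenvalue `lam`, of the
Neumann Laplacian of `Ω`, the self-adjoint operator of the form `∫_Ω g(∇u, ∇v)` with form domain
`H¹(Ω)`: it is a nonzero element of `H¹(Ω)`, and `∫_Ω g(∇u, ∇v) = lam ∫_Ω u v` for all `v` in
`H¹(Ω)`. -/
def IsNeumannEigenfunction (g : Metric M) (Ω : Set M) (u : M → ℝ) (lam : ℝ) : Prop :=
  ∃ U : VField M, IsSobolev g Ω u U ∧
    ¬ (∀ᵐ x ∂((riemannianVolume g).restrict Ω), u x = 0) ∧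
    ∀ (v : M → ℝ) (V : VField M), IsSobolev g Ω v V →
      ∫ x in Ω, g.inner x (U x) (V x) ∂(riemannianVolume g) =
        lam * ∫ x in Ω, u x * v x ∂(riemannianVolume g)

/-- The normal derivative of `f` vanishes on `∂Ω`: at each boundary point, `∇f` is orthogonal to
the gradient of every function `h` that vanishes on `∂Ω` near that point. Where `∂Ω` is a `C¹`
curve `{h = 0}` with `∇h ≠ 0`, the unit normal is `±∇h / |∇h|`. -/
def NormalDerivativeVanishes (g : Metric M) (Ω : Set M) (f : M → ℝ) : Prop :=
  ∀ x ∈ frontier Ω, ∀ h : M → ℝ, MDifferentiableAt (𝓡 2) 𝓘(ℝ, ℝ) h x →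
    (∀ᶠ y in 𝓝[frontier Ω] x, h y = 0) →
    g.inner x (grad g h x) (grad g f x) = 0

end Neumann

end NeumannDomains

/-!
A Neumann domain `Ω` is a union of gradient flow lines, so its frontier, although it need not be
smooth, is invariant under the flow of `∇f`. Because `∇f` is Lipschitz in charts, flow lines
separate from the frontier at most exponentially, so the distance to `∂Ω` has a logarithmic
derivative along `∇f` that stays bounded. Cutoff functions built from it exhaust `Ω` while their
derivatives along `∇f` stay bounded, and passing to the limit in the divergence theorem gives
Green's identity `∫_Ω v Δf = -∫_Ω g(∇f, ∇v)` without a boundary term for every `v` in `H¹(Ω)`. A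
function that vanishes on `∂Ω` near a boundary point `x` is constant along the flow line of `∇f`
through `x`, and this is the vanishing of the normal derivative.
-/

namespace NeumannDomains

section Components

variable {M : Type*} [TopologicalSpace M] [ChartedSpace Plane M] [IsManifold (𝓡 2) ∞ M]

/-- `X` is a continuously differentiable vector field, as a section of the tangent bundle. -/
def IsC1Field (X : VField M) : Prop :=
  ContMDiff (𝓡 2) (𝓡 2).tangent 1 (fun x => (⟨x, X x⟩ : TangentBundle (𝓡 2) M))

theorem components_eq_trivializationAt (c : M) (X : VField M) {x : M}
    (hx : x ∈ (chartAt Plane c).source) :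
    components c X x = (trivializationAt Plane (TangentSpace (𝓡 2)) c ⟨x, X x⟩).2 := by
  have key := congrArg (fun l => l (X x))
    (TangentBundle.continuousLinearMapAt_trivializationAt (I := 𝓡 2) hx)
  have hchart : (extChartAt (𝓡 2) c : M → Plane) = chartAt Plane c := by ext; simp
  rw [components, ← hchart]
  refine key.symm.trans ?_
  rw [Bundle.Trivialization.continuousLinearMapAt_apply,
    Bundle.Trivialization.linearMapAt_apply, if_pos]
  simpa using hx

theorem contMDiffOn_section_iff_components {n : ℕ∞ω} [ENat.LEInfty n] (c : M) (X : VField M) :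
    ContMDiffOn (𝓡 2) (𝓡 2).tangent n (fun x => (⟨x, X x⟩ : TangentBundle (𝓡 2) M))
        (chartAt Plane c).source ↔
      ContMDiffOn (𝓡 2) 𝓘(ℝ, Plane) n (components c X) (chartAt Plane c).source := by
  rw [Bundle.Trivialization.contMDiffOn_section_iff
    (trivializationAt Plane (TangentSpace (𝓡 2)) c) (chartAt Plane c).open_source (by simp)]
  exact contMDiffOn_congr fun x hx => (components_eq_trivializationAt c X hx).symm

theorem contMDiffOn_iff_contDiffOn_chart {E : Type*} [NormedAddCommGroup E] [NormedSpace ℝ E]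
    {n : ℕ∞ω} [ENat.LEInfty n] (c : M) (u : M → E) :
    ContMDiffOn (𝓡 2) 𝓘(ℝ, E) n u (chartAt Plane c).source ↔
      ContDiffOn ℝ n (u ∘ (chartAt Plane c).symm) (chartAt Plane c).target := by
  rw [← contMDiffOn_iff_contDiffOn]
  constructor
  · intro h
    exact h.comp contMDiffOn_chart_symm fun y hy => (chartAt Plane c).map_target hy
  · intro h
    refine (h.comp (contMDiffOn_chart (I := 𝓡 2) (n := n) (x := c))
      fun y hy => (chartAt Plane c).map_source hy).congr fun x hx => ?_
    simp only [Function.comp_apply, (chartAt Plane c).left_inv hx]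

theorem isC1Field_iff (X : VField M) :
    IsC1Field X ↔ ∀ c : M, ContDiffOn ℝ 1 (components c X ∘ (chartAt Plane c).symm)
      (chartAt Plane c).target := by
  simp only [← contMDiffOn_iff_contDiffOn_chart, ← contMDiffOn_section_iff_components]
  exact ⟨fun h c => h.contMDiffOn, fun h x => (h x).contMDiffAt
    ((chartAt Plane x).open_source.mem_nhds (mem_chart_source _ x))⟩

theorem continuousOn_components (c : M) {X : VField M} (hX : IsC1Field X) :
    ContinuousOn (components c X) (chartAt Plane c).source :=
  ((contMDiffOn_section_iff_components c X).1 hX.contMDiffOn).continuousOn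

omit [IsManifold (𝓡 2) ∞ M] in
theorem mfderiv_apply_of_eq {E : Type*} [NormedAddCommGroup E] [NormedSpace ℝ E] (u : M → E)
    {x x' : M} (h : x' = x) (v : Plane) :
    (mfderiv (𝓡 2) 𝓘(ℝ, E) u x' v : E) = mfderiv (𝓡 2) 𝓘(ℝ, E) u x v := by
  subst h; rfl

theorem mfderiv_chart_symm_components (c : M) (X : VField M) {x : M}
    (hx : x ∈ (chartAt Plane c).source) :
    (mfderiv (𝓡 2) (𝓡 2) (chartAt Plane c).symm (chartAt Plane c x) (components c X x) : Plane)
      = X x :=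
  congrArg (fun l => l (X x)) ((mdifferentiable_chart (I := 𝓡 2) c).symm_comp_deriv hx)

theorem mfderiv_chart_mfderiv_symm (c : M) {x : M} (hx : x ∈ (chartAt Plane c).source)
    (v : Plane) :
    (mfderiv (𝓡 2) (𝓡 2) (chartAt Plane c) x
      (mfderiv (𝓡 2) (𝓡 2) (chartAt Plane c).symm (chartAt Plane c x) v : Plane) : Plane) = v :=
  (mfderiv_apply_of_eq _ ((chartAt Plane c).left_inv hx) _).symm.trans <|
    congrArg (fun l => l v)
      ((mdifferentiable_chart (I := 𝓡 2) c).comp_symm_deriv ((chartAt Plane c).map_source hx))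

theorem exists_components_eq (c : M) {x : M} (hx : x ∈ (chartAt Plane c).source) (v : Plane) :
    ∃ X : VField M, components c X x = v :=
  ⟨fun x' => (mfderiv (𝓡 2) (𝓡 2) (chartAt Plane c).symm (chartAt Plane c x') v : Plane),
    mfderiv_chart_mfderiv_symm c hx v⟩

theorem differentiableAt_comp_chart_symm {E : Type*} [NormedAddCommGroup E] [NormedSpace ℝ E]
    (c : M) {u : M → E} {x : M} (hx : x ∈ (chartAt Plane c).source)
    (hu : MDifferentiableAt (𝓡 2) 𝓘(ℝ, E) u x) :
    DifferentiableAt ℝ (u ∘ (chartAt Plane c).symm) (chartAt Plane c x) := by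
  rw [← mdifferentiableAt_iff_differentiableAt]
  refine MDifferentiableAt.comp _ (by rwa [(chartAt Plane c).left_inv hx]) ?_
  exact (mdifferentiable_chart c).mdifferentiableAt_symm ((chartAt Plane c).map_source hx)

theorem mfderiv_eq_fderiv_chart {E : Type*} [NormedAddCommGroup E] [NormedSpace ℝ E]
    (c : M) {u : M → E} {x : M} (hx : x ∈ (chartAt Plane c).source)
    (hu : MDifferentiableAt (𝓡 2) 𝓘(ℝ, E) u x) (X : VField M) :
    (mfderiv (𝓡 2) 𝓘(ℝ, E) u x (X x) : E) =
      fderiv ℝ (u ∘ (chartAt Plane c).symm) (chartAt Plane c x) (components c X x) := by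
  have hl : (chartAt Plane c).symm (chartAt Plane c x) = x := (chartAt Plane c).left_inv hx
  have hd : MDifferentiableAt (𝓡 2) (𝓡 2) (chartAt Plane c).symm (chartAt Plane c x) :=
    (mdifferentiable_chart c).mdifferentiableAt_symm ((chartAt Plane c).map_source hx)
  have hchain := mfderiv_comp (chartAt Plane c x) (by rwa [hl]) hd (g := u)
  rw [← mfderiv_eq_fderiv]
  refine Eq.trans ?_ (congrArg (fun l => l (components c X x)) hchain).symm
  refine (mfderiv_apply_of_eq u hl (X x)).symm.trans ?_
  exact congrArg (fun v : Plane => (mfderiv (𝓡 2) 𝓘(ℝ, E) u _ v : E))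
    (mfderiv_chart_symm_components c X hx).symm

end Components

section Gram

open scoped Matrix

variable {M : Type*} [TopologicalSpace M] [ChartedSpace Plane M] [IsManifold (𝓡 2) ∞ M]

/-- The coordinate vector field `∂_i` of the chart centred at `c`. -/
noncomputable def frame (c : M) (i : Fin 2) : VField M :=
  fun x => (coordVec c (chartAt Plane c x) i : Plane)

theorem components_frame (c : M) (i : Fin 2) {x : M} (hx : x ∈ (chartAt Plane c).source) :
    components c (frame c i) x = EuclideanSpace.single i (1 : ℝ) :=
  mfderiv_chart_mfderiv_symm c hx _

theorem contMDiffOn_frame (c : M) (i : Fin 2) :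
    ContMDiffOn (𝓡 2) (𝓡 2).tangent ∞
      (fun x => (⟨x, frame c i x⟩ : TangentBundle (𝓡 2) M)) (chartAt Plane c).source :=
  (contMDiffOn_section_iff_components c _).2 <|
    contMDiffOn_const.congr fun _ hx => components_frame c i hx

theorem map_eq_sum_smul_single {ι E : Type*} [Fintype ι] [DecidableEq ι] [NormedAddCommGroup E]
    [NormedSpace ℝ E] (l : EuclideanSpace ℝ ι →L[ℝ] E) (v : EuclideanSpace ℝ ι) :
    l v = ∑ i, v i • l (EuclideanSpace.single i 1) := by
  conv_lhs => rw [← (EuclideanSpace.basisFun ι ℝ).sum_repr v]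
  simp only [map_sum, map_smul, EuclideanSpace.basisFun_repr, EuclideanSpace.basisFun_apply]

theorem eq_sum_frame (c : M) (X : VField M) {x : M} (hx : x ∈ (chartAt Plane c).source) :
    X x = ∑ i, components c X x i • frame c i x :=
  (mfderiv_chart_symm_components c X hx).symm.trans <|
    map_eq_sum_smul_single (E := Plane)
      (mfderiv (𝓡 2) (𝓡 2) (chartAt Plane c).symm (chartAt Plane c x)) (components c X x)

theorem gram_chart (g : Metric M) (c : M) {x : M} (hx : x ∈ (chartAt Plane c).source)
    (i j : Fin 2) :
    gram g c (chartAt Plane c x) i j = g.inner x (frame c i x) (frame c j x) := by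
  have hbase : ∀ x' : M, x' = x → ∀ v w : Plane,
      g.inner x' (v : Plane) (w : Plane) = g.inner x (v : Plane) (w : Plane) := by
    rintro _ rfl _ _; rfl
  exact hbase _ ((chartAt Plane c).left_inv hx) _ _

theorem inner_eq_dotProduct_gram (g : Metric M) (c : M) (X Y : VField M) {x : M}
    (hx : x ∈ (chartAt Plane c).source) :
    g.inner x (X x) (Y x) = (components c X x).ofLp ⬝ᵥ
      (gram g c (chartAt Plane c x) *ᵥ (components c Y x).ofLp) := by
  conv_lhs => rw [eq_sum_frame c X hx, eq_sum_frame c Y hx]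
  simp only [dotProduct, Matrix.mulVec, gram_chart g c hx, Fin.sum_univ_two, map_add, map_smul,
    add_apply, smul_apply, smul_eq_mul]
  ring

theorem contMDiffOn_inner {n : ℕ∞ω} [ENat.LEInfty n] (g : Metric M) {X Y : VField M} {s : Set M}
    (hX : ContMDiffOn (𝓡 2) (𝓡 2).tangent n (fun x => (⟨x, X x⟩ : TangentBundle (𝓡 2) M)) s)
    (hY : ContMDiffOn (𝓡 2) (𝓡 2).tangent n (fun x => (⟨x, Y x⟩ : TangentBundle (𝓡 2) M)) s) :
    ContMDiffOn (𝓡 2) 𝓘(ℝ, ℝ) n (fun x => g.inner x (X x) (Y x)) s := by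
  have hbundle := (g.contMDiff.of_le (m := n) ENat.LEInfty.out).contMDiffOn.clm_bundle_apply₂
    (F₁ := Plane) (F₂ := Plane) hX hY
  exact fun x hx => by simpa using ((Bundle.contMDiffWithinAt_totalSpace).1 (hbundle x hx)).2

theorem continuous_inner (g : Metric M) {X Y : VField M} (hX : IsC1Field X) (hY : IsC1Field Y) :
    Continuous fun x => g.inner x (X x) (Y x) :=
  continuousOn_univ.1 (contMDiffOn_inner g hX.contMDiffOn hY.contMDiffOn).continuousOn

theorem contDiffOn_gram (g : Metric M) (c : M) (i j : Fin 2) :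
    ContDiffOn ℝ ∞ (fun y => gram g c y i j) (chartAt Plane c).target := by
  have hinner := contMDiffOn_inner g (contMDiffOn_frame c i) (contMDiffOn_frame c j)
  refine ((contMDiffOn_iff_contDiffOn_chart c _).1 hinner).congr fun y hy => ?_
  have hy' := gram_chart g c ((chartAt Plane c).map_target hy) i j
  rwa [(chartAt Plane c).right_inv hy] at hy'

theorem posDef_gram (g : Metric M) (c : M) {y : Plane} (hy : y ∈ (chartAt Plane c).target) :
    (gram g c y).PosDef := by
  have hx := (chartAt Plane c).map_target hy
  refine .of_dotProduct_mulVec_pos (by ext i j; exact g.symm _ _ _) fun v hv => ?_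
  obtain ⟨X, hX⟩ := exists_components_eq c hx (WithLp.toLp 2 v)
  have hinner := inner_eq_dotProduct_gram g c X X hx
  rw [hX, (chartAt Plane c).right_inv hy] at hinner
  rw [star_trivial, ← hinner]
  refine g.pos _ _ fun h0 => hv ?_
  have hzero : WithLp.toLp 2 v = 0 := by
    rw [← hX, components, h0]
    exact map_zero (mfderiv (𝓡 2) (𝓡 2) (chartAt Plane c) _)
  simpa using hzero

theorem gram_det_pos (g : Metric M) (c : M) {y : Plane} (hy : y ∈ (chartAt Plane c).target) :
    0 < (gram g c y).det :=
  (posDef_gram g c hy).det_pos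

theorem contDiffOn_gram_det (g : Metric M) (c : M) :
    ContDiffOn ℝ ∞ (fun y => (gram g c y).det) (chartAt Plane c).target := by
  simp only [Matrix.det_fin_two]
  exact ((contDiffOn_gram g c 0 0).mul (contDiffOn_gram g c 1 1)).sub
    ((contDiffOn_gram g c 0 1).mul (contDiffOn_gram g c 1 0))

theorem density_pos (g : Metric M) (c : M) {y : Plane} (hy : y ∈ (chartAt Plane c).target) :
    0 < density g c y := Real.sqrt_pos.2 (gram_det_pos g c hy)

theorem contDiffOn_density (g : Metric M) (c : M) :
    ContDiffOn ℝ ∞ (density g c) (chartAt Plane c).target :=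
  (contDiffOn_gram_det g c).sqrt fun _ hy => (gram_det_pos g c hy).ne'

theorem inner_self_nonneg (g : Metric M) (x : M) (v : TangentSpace (𝓡 2) x) :
    0 ≤ g.inner x v v := by
  rcases eq_or_ne v 0 with rfl | hv
  · simp
  · exact (g.pos x v hv).le

theorem abs_inner_le (g : Metric M) (x : M) (v w : TangentSpace (𝓡 2) x) :
    |g.inner x v w| ≤ g.inner x v v + g.inner x w w := by
  have hadd := inner_self_nonneg g x (v + w)
  have hsub := inner_self_nonneg g x (v - w)
  simp only [map_add, map_sub, add_apply, sub_apply, g.symm x w v] at hadd hsub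
  rw [abs_le]
  constructor <;> linarith [inner_self_nonneg g x v, inner_self_nonneg g x w]

end Gram

section Gradient

open scoped Matrix

variable {M : Type*} [TopologicalSpace M] [ChartedSpace Plane M] [IsManifold (𝓡 2) ∞ M]

theorem gram_mulVec_components_grad (g : Metric M) (c : M) {f : M → ℝ} {x : M}
    (hx : x ∈ (chartAt Plane c).source) (hf : MDifferentiableAt (𝓡 2) 𝓘(ℝ, ℝ) f x) (i : Fin 2) :
    (gram g c (chartAt Plane c x) *ᵥ (components c (grad g f) x).ofLp) i =
      fderiv ℝ (f ∘ (chartAt Plane c).symm) (chartAt Plane c x) (EuclideanSpace.single i 1) := by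
  have hgrad := inner_grad g f x (frame c i x)
  rw [g.symm, inner_eq_dotProduct_gram g c _ _ hx, components_frame c i hx] at hgrad
  refine Eq.trans (by simp) (hgrad.trans ?_)
  refine (mfderiv_eq_fderiv_chart c hx hf (frame c i)).trans ?_
  rw [components_frame c i hx]

theorem components_grad_apply (g : Metric M) (c : M) {f : M → ℝ} {x : M}
    (hx : x ∈ (chartAt Plane c).source) (hf : MDifferentiableAt (𝓡 2) 𝓘(ℝ, ℝ) f x) (i : Fin 2) :
    components c (grad g f) x i = ((gram g c (chartAt Plane c x)).det)⁻¹ *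
      ∑ j, (gram g c (chartAt Plane c x)).adjugate i j *
        fderiv ℝ (f ∘ (chartAt Plane c).symm) (chartAt Plane c x) (EuclideanSpace.single j 1) := by
  have hdet := (gram_det_pos g c ((chartAt Plane c).map_source hx)).ne'
  rw [eq_inv_mul_iff_mul_eq₀ hdet]
  simp only [← gram_mulVec_components_grad g c hx hf]
  change _ = ((gram g c (chartAt Plane c x)).adjugate *ᵥ _) i
  rw [Matrix.mulVec_mulVec, Matrix.adjugate_mul, Matrix.smul_mulVec, Matrix.one_mulVec,
    Pi.smul_apply, smul_eq_mul]

theorem contDiffOn_adjugate_gram (g : Metric M) (c : M) (i j : Fin 2) :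
    ContDiffOn ℝ ∞ (fun y => (gram g c y).adjugate i j) (chartAt Plane c).target := by
  simp only [Matrix.adjugate_fin_two]
  fin_cases i <;> fin_cases j
  exacts [contDiffOn_gram g c 1 1, (contDiffOn_gram g c 0 1).neg, (contDiffOn_gram g c 1 0).neg,
    contDiffOn_gram g c 0 0]

theorem isC1Field_grad (g : Metric M) {f : M → ℝ} (hf : ContMDiff (𝓡 2) 𝓘(ℝ, ℝ) 2 f) :
    IsC1Field (grad g f) := by
  refine (isC1Field_iff _).2 fun c => contDiffOn_euclidean.2 fun i => ?_
  have hpartial (j : Fin 2) : ContDiffOn ℝ 1 (fun y => fderiv ℝ (f ∘ (chartAt Plane c).symm) y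
      (EuclideanSpace.single j 1)) (chartAt Plane c).target :=
    ((((contMDiffOn_iff_contDiffOn_chart c f).1 hf.contMDiffOn).fderiv_of_isOpen
      (chartAt Plane c).open_target (m := 1) one_add_one_eq_two.le)).clm_apply contDiffOn_const
  have hone : (1 : ℕ∞ω) ≤ ∞ := ENat.LEInfty.out
  have hsum : ContDiffOn ℝ 1 (fun y => ∑ j, (gram g c y).adjugate i j *
      fderiv ℝ (f ∘ (chartAt Plane c).symm) y (EuclideanSpace.single j 1))
      (chartAt Plane c).target :=
    ContDiffOn.sum fun j _ => ((contDiffOn_adjugate_gram g c i j).of_le hone).mul (hpartial j)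
  refine ((((contDiffOn_gram_det g c).of_le hone).inv fun y hy =>
    (gram_det_pos g c hy).ne').mul hsum).congr fun y hy => ?_
  have hy' := components_grad_apply g c ((chartAt Plane c).map_target hy)
    (hf.mdifferentiableAt two_ne_zero) i
  simp only [(chartAt Plane c).right_inv hy] at hy'
  exact hy'

end Gradient

section PlaneCalculus

theorem det_fin_two_eq (l : Plane →L[ℝ] Plane) :
    l.det = l (EuclideanSpace.single 0 1) 0 * l (EuclideanSpace.single 1 1) 1 -
      l (EuclideanSpace.single 1 1) 0 * l (EuclideanSpace.single 0 1) 1 := by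
  rw [ContinuousLinearMap.det,
    ← LinearMap.det_toMatrix (EuclideanSpace.basisFun (Fin 2) ℝ).toBasis, Matrix.det_fin_two]
  simp [LinearMap.toMatrix_apply]

/-- The Euclidean divergence `∑ i, ∂_i W^i`. -/
noncomputable def euclideanDiv {ι : Type*} [Fintype ι] [DecidableEq ι]
    (W : EuclideanSpace ℝ ι → EuclideanSpace ℝ ι) (y : EuclideanSpace ℝ ι) : ℝ :=
  ∑ i, fderiv ℝ (fun z => W z i) y (EuclideanSpace.single i 1)

theorem euclideanDiv_congr {ι : Type*} [Fintype ι] [DecidableEq ι]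
    {W W' : EuclideanSpace ℝ ι → EuclideanSpace ℝ ι} {y : EuclideanSpace ℝ ι} (h : W =ᶠ[𝓝 y] W') :
    euclideanDiv W y = euclideanDiv W' y := by
  refine Finset.sum_congr rfl fun i _ => ?_
  have hi : (fun z => W z i) =ᶠ[𝓝 y] fun z => W' z i :=
    h.fun_comp fun v : EuclideanSpace ℝ ι => v i
  rw [hi.fderiv_eq]

theorem euclideanDiv_const_smul {ι : Type*} [Fintype ι] [DecidableEq ι]
    (s : ℝ) (W : EuclideanSpace ℝ ι → EuclideanSpace ℝ ι) (y : EuclideanSpace ℝ ι) :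
    euclideanDiv (fun z => s • W z) y = s * euclideanDiv W y := by
  simp only [euclideanDiv, PiLp.smul_apply, smul_eq_mul, Finset.mul_sum]
  refine Finset.sum_congr rfl fun i _ => ?_
  exact congrArg (fun l => l y (EuclideanSpace.single i 1))
    (fderiv_const_smul_field (𝕜 := ℝ) (f := fun z => W z i) s)

theorem euclideanDiv_smul {ι : Type*} [Fintype ι] [DecidableEq ι] {b : EuclideanSpace ℝ ι → ℝ}
    {W : EuclideanSpace ℝ ι → EuclideanSpace ℝ ι} {y : EuclideanSpace ℝ ι}
    (hb : DifferentiableAt ℝ b y) (hW : DifferentiableAt ℝ W y) :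
    euclideanDiv (fun z => b z • W z) y = b y * euclideanDiv W y + fderiv ℝ b y (W y) := by
  rw [map_eq_sum_smul_single (fderiv ℝ b y), euclideanDiv, euclideanDiv, Finset.mul_sum,
    ← Finset.sum_add_distrib]
  refine Finset.sum_congr rfl fun i _ => ?_
  have hprod := fderiv_fun_mul hb (differentiableAt_euclidean.1 hW i)
  exact congrArg (fun l => l (EuclideanSpace.single i 1)) hprod

theorem hasFDerivAt_fderiv_apply {τ : Plane → Plane} {y : Plane}
    (hτ : DifferentiableAt ℝ (fderiv ℝ τ) y) (i j : Fin 2) :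
    HasFDerivAt (fun z => fderiv ℝ τ z (EuclideanSpace.single i 1) j)
      ((EuclideanSpace.proj j : Plane →L[ℝ] ℝ).comp
        ((ContinuousLinearMap.apply ℝ Plane (EuclideanSpace.single i (1 : ℝ) : Plane)).comp
          (fderiv ℝ (fderiv ℝ τ) y))) y :=
  (EuclideanSpace.proj j : Plane →L[ℝ] ℝ).hasFDerivAt.comp y
    ((ContinuousLinearMap.apply ℝ Plane
      (EuclideanSpace.single i (1 : ℝ) : Plane)).hasFDerivAt.comp y hτ.hasFDerivAt)

theorem apply_eq_of_map_eq_det_smul {l : Plane →L[ℝ] Plane} (hl : l.det ≠ 0) {v w : Plane}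
    (h : l v = l.det • w) :
    v 0 = l (EuclideanSpace.single 1 1) 1 * w 0 - l (EuclideanSpace.single 1 1) 0 * w 1 ∧
    v 1 = l (EuclideanSpace.single 0 1) 0 * w 1 - l (EuclideanSpace.single 0 1) 1 * w 0 := by
  have hcoord (i : Fin 2) : v 0 * l (EuclideanSpace.single 0 1) i +
      v 1 * l (EuclideanSpace.single 1 1) i = l.det * w i := by
    have hi := congrArg (fun u : Plane => u i) h
    rw [map_eq_sum_smul_single l v] at hi
    simpa [Fin.sum_univ_two] using hi
  have hdet := det_fin_two_eq l
  constructor <;> refine mul_left_cancel₀ hl ?_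
  · linear_combination v 0 * hdet + l (EuclideanSpace.single 1 1) 1 * hcoord 0
      - l (EuclideanSpace.single 1 1) 0 * hcoord 1
  · linear_combination v 1 * hdet + l (EuclideanSpace.single 0 1) 0 * hcoord 1
      - l (EuclideanSpace.single 0 1) 1 * hcoord 0

/-- The Piola identity: the second derivatives of `τ` cancel by symmetry, because the rows of the
adjugate of the Jacobian matrix are divergence free. -/
theorem euclideanDiv_piola {τ W W' : Plane → Plane} {y : Plane} (hτ : ContDiffAt ℝ 2 τ y)
    (hW' : DifferentiableAt ℝ W' (τ y)) (hdet : ∀ᶠ z in 𝓝 y, (fderiv ℝ τ z).det ≠ 0)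
    (hW : ∀ᶠ z in 𝓝 y, fderiv ℝ τ z (W z) = (fderiv ℝ τ z).det • W' (τ z)) :
    euclideanDiv W y = (fderiv ℝ τ y).det * euclideanDiv W' (τ y) := by
  have hτ' : DifferentiableAt ℝ τ y := hτ.differentiableAt two_ne_zero
  have hτ'' : DifferentiableAt ℝ (fderiv ℝ τ) y :=
    (hτ.fderiv_right (m := 1) one_add_one_eq_two.le).differentiableAt one_ne_zero
  have hJ := hasFDerivAt_fderiv_apply hτ''
  have hWτ (i : Fin 2) : HasFDerivAt (fun z => W' (τ z) i)
      ((fderiv ℝ (fun z => W' z i) (τ y)).comp (fderiv ℝ τ y)) y :=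
    ((differentiableAt_euclidean.1 hW' i).hasFDerivAt (f := fun z => W' z i)).comp y
      hτ'.hasFDerivAt
  have hW₀ : (fun z => W z 0) =ᶠ[𝓝 y] _ :=
    (hdet.and hW).mono fun z hz => (apply_eq_of_map_eq_det_smul hz.1 hz.2).1
  have hW₁ : (fun z => W z 1) =ᶠ[𝓝 y] _ :=
    (hdet.and hW).mono fun z hz => (apply_eq_of_map_eq_det_smul hz.1 hz.2).2
  have hderiv₀ := hW₀.fderiv_eq.trans (((hJ 1 1).mul (hWτ 0)).sub ((hJ 1 0).mul (hWτ 1))).fderiv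
  have hderiv₁ := hW₁.fderiv_eq.trans (((hJ 0 0).mul (hWτ 1)).sub ((hJ 0 1).mul (hWτ 0))).fderiv
  have hsymm := (hτ.isSymmSndFDerivAt (by simp)) (EuclideanSpace.single 0 1)
    (EuclideanSpace.single 1 1)
  rw [euclideanDiv, euclideanDiv, Fin.sum_univ_two, Fin.sum_univ_two, hderiv₀, hderiv₁,
    det_fin_two_eq]
  simp only [add_apply, sub_apply, smul_apply, ContinuousLinearMap.comp_apply, smul_eq_mul,
    ContinuousLinearMap.apply_apply, PiLp.proj_apply, hsymm]
  rw [map_eq_sum_smul_single (fderiv ℝ (fun z => W' z 0) (τ y)) (fderiv ℝ τ y _),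
    map_eq_sum_smul_single (fderiv ℝ (fun z => W' z 0) (τ y)) (fderiv ℝ τ y _),
    map_eq_sum_smul_single (fderiv ℝ (fun z => W' z 1) (τ y)) (fderiv ℝ τ y _),
    map_eq_sum_smul_single (fderiv ℝ (fun z => W' z 1) (τ y)) (fderiv ℝ τ y _)]
  simp only [Fin.sum_univ_two, smul_eq_mul]
  ring

end PlaneCalculus

section Transition

open scoped Matrix

variable {M : Type*} [TopologicalSpace M] [ChartedSpace Plane M] [IsManifold (𝓡 2) ∞ M]

/-- The transition map from the chart centred at `c` to the chart centred at `d`. -/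
noncomputable def transition (c d : M) : Plane → Plane :=
  chartAt Plane d ∘ (chartAt Plane c).symm

omit [IsManifold (𝓡 2) ∞ M] in
theorem transition_chart (c d : M) {x : M} (hc : x ∈ (chartAt Plane c).source) :
    transition c d (chartAt Plane c x) = chartAt Plane d x := by
  rw [transition, Function.comp_apply, (chartAt Plane c).left_inv hc]

theorem contDiffAt_transition (c d : M) {x : M} (hc : x ∈ (chartAt Plane c).source)
    (hd : x ∈ (chartAt Plane d).source) :
    ContDiffAt ℝ ∞ (transition c d) (chartAt Plane c x) := by
  rw [← contMDiffAt_iff_contDiffAt]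
  have hsymm : ContMDiffAt (𝓡 2) (𝓡 2) ∞ (chartAt Plane c).symm (chartAt Plane c x) :=
    contMDiffOn_chart_symm.contMDiffAt
      ((chartAt Plane c).open_target.mem_nhds ((chartAt Plane c).map_source hc))
  have hchart : ContMDiffAt (𝓡 2) (𝓡 2) ∞ (chartAt Plane d) x :=
    contMDiffOn_chart.contMDiffAt ((chartAt Plane d).open_source.mem_nhds hd)
  exact ContMDiffAt.comp _ (by rwa [(chartAt Plane c).left_inv hc]) hsymm

theorem components_transition (c d : M) (X : VField M) {x : M}
    (hc : x ∈ (chartAt Plane c).source) (hd : x ∈ (chartAt Plane d).source) :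
    components d X x = fderiv ℝ (transition c d) (chartAt Plane c x) (components c X x) :=
  mfderiv_eq_fderiv_chart c hc ((mdifferentiable_chart d).mdifferentiableAt hd) X

theorem det_fderiv_transition_ne_zero (c d : M) {x : M}
    (hc : x ∈ (chartAt Plane c).source) (hd : x ∈ (chartAt Plane d).source) :
    (fderiv ℝ (transition c d) (chartAt Plane c x)).det ≠ 0 := by
  intro hdet
  obtain ⟨v, hv, hv0⟩ := (Submodule.ne_bot_iff _).1 (LinearMap.bot_lt_ker_of_det_eq_zero hdet).ne'
  obtain ⟨X, hX⟩ := exists_components_eq c hc v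
  have hback := components_transition d c X hd hc
  rw [components_transition c d X hc hd, hX] at hback
  rw [hback, show fderiv ℝ (transition c d) (chartAt Plane c x) v = 0 from hv, map_zero] at hv0
  exact hv0 rfl

theorem gram_transition (g : Metric M) (c d : M) {x : M}
    (hc : x ∈ (chartAt Plane c).source) (hd : x ∈ (chartAt Plane d).source) :
    let J := LinearMap.toMatrix (EuclideanSpace.basisFun (Fin 2) ℝ).toBasis
      (EuclideanSpace.basisFun (Fin 2) ℝ).toBasis
      (fderiv ℝ (transition c d) (chartAt Plane c x) : Plane →ₗ[ℝ] Plane)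
    gram g c (chartAt Plane c x) = Jᵀ * gram g d (chartAt Plane d x) * J := by
  ext i j
  rw [gram_chart g c hc, inner_eq_dotProduct_gram g d _ _ hd, components_transition c d _ hc hd,
    components_transition c d _ hc hd, components_frame c i hc, components_frame c j hc,
    Matrix.mul_assoc]
  simp [Matrix.mul_apply, dotProduct, Matrix.mulVec, LinearMap.toMatrix_apply]

theorem density_transition (g : Metric M) (c d : M) {x : M}
    (hc : x ∈ (chartAt Plane c).source) (hd : x ∈ (chartAt Plane d).source) :
    density g c (chartAt Plane c x) =
      |(fderiv ℝ (transition c d) (chartAt Plane c x)).det| * density g d (chartAt Plane d x) := by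
  have hdet : (gram g c (chartAt Plane c x)).det =
      (fderiv ℝ (transition c d) (chartAt Plane c x)).det ^ 2 *
        (gram g d (chartAt Plane d x)).det := by
    rw [gram_transition g c d hc hd, Matrix.det_mul, Matrix.det_mul, Matrix.det_transpose,
      LinearMap.det_toMatrix, ContinuousLinearMap.det]
    ring
  rw [density, density, hdet, Real.sqrt_mul (sq_nonneg _), Real.sqrt_sq_eq_abs]

omit [IsManifold (𝓡 2) ∞ M] in
theorem eventually_exists_chart_eq (c d : M) {x : M} (hc : x ∈ (chartAt Plane c).source)
    (hd : x ∈ (chartAt Plane d).source) : ∀ᶠ z in 𝓝 (chartAt Plane c x),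
      ∃ x' ∈ (chartAt Plane c).source, x' ∈ (chartAt Plane d).source ∧ chartAt Plane c x' = z := by
  have htarget : (chartAt Plane c).target ∈ 𝓝 (chartAt Plane c x) :=
    (chartAt Plane c).open_target.mem_nhds ((chartAt Plane c).map_source hc)
  have hsource : (chartAt Plane d).source ∈ 𝓝 ((chartAt Plane c).symm (chartAt Plane c x)) := by
    rw [(chartAt Plane c).left_inv hc]
    exact (chartAt Plane d).open_source.mem_nhds hd
  filter_upwards [htarget,
    (chartAt Plane c).continuousAt_symm ((chartAt Plane c).map_source hc) hsource] with z hz hz'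
  exact ⟨_, (chartAt Plane c).map_target hz, hz', (chartAt Plane c).right_inv hz⟩

theorem exists_eventually_abs_det_transition_eq (c d : M) {x : M}
    (hc : x ∈ (chartAt Plane c).source) (hd : x ∈ (chartAt Plane d).source) :
    ∃ s : ℝ, ∀ᶠ z in 𝓝 (chartAt Plane c x),
      |(fderiv ℝ (transition c d) z).det| = (fderiv ℝ (transition c d) z).det * s := by
  have hcont : ContinuousAt (fun z => (fderiv ℝ (transition c d) z).det) (chartAt Plane c x) :=
    ContinuousLinearMap.continuous_det.continuousAt.comp
      ((contDiffAt_transition c d hc hd).fderiv_right (m := 1)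
        (one_add_one_eq_two.trans_le ENat.LEInfty.out)).continuousAt
  rcases lt_or_gt_of_ne (det_fderiv_transition_ne_zero c d hc hd) with h | h
  · exact ⟨-1, (hcont.eventually (gt_mem_nhds h)).mono fun z hz => by
      rw [abs_of_neg hz, mul_neg_one]⟩
  · exact ⟨1, (hcont.eventually (lt_mem_nhds h)).mono fun z hz => by
      rw [abs_of_pos hz, mul_one]⟩

end Transition

section Divergence

variable {M : Type*} [TopologicalSpace M] [ChartedSpace Plane M] [IsManifold (𝓡 2) ∞ M]

/-- The vector density `√(det g) X` in the chart centred at `c`, whose Euclidean divergence is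
`√(det g) div X`. -/
noncomputable def vectorDensity (g : Metric M) (c : M) (X : VField M) (y : Plane) : Plane :=
  density g c y • components c X ((chartAt Plane c).symm y)

theorem contDiffOn_vectorDensity (g : Metric M) (c : M) {X : VField M} (hX : IsC1Field X) :
    ContDiffOn ℝ 1 (vectorDensity g c X) (chartAt Plane c).target :=
  ((contDiffOn_density g c).of_le ENat.LEInfty.out).smul ((isC1Field_iff X).1 hX c)

theorem differentiableAt_vectorDensity (g : Metric M) (c : M) {X : VField M} (hX : IsC1Field X)
    {x : M} (hx : x ∈ (chartAt Plane c).source) :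
    DifferentiableAt ℝ (vectorDensity g c X) (chartAt Plane c x) :=
  ((contDiffOn_vectorDensity g c hX).contDiffAt ((chartAt Plane c).open_target.mem_nhds
    ((chartAt Plane c).map_source hx))).differentiableAt one_ne_zero

theorem fderiv_transition_vectorDensity (g : Metric M) (c d : M) (X : VField M) {x : M}
    (hc : x ∈ (chartAt Plane c).source) (hd : x ∈ (chartAt Plane d).source) :
    fderiv ℝ (transition c d) (chartAt Plane c x) (vectorDensity g c X (chartAt Plane c x)) =
      |(fderiv ℝ (transition c d) (chartAt Plane c x)).det| •
        vectorDensity g d X (chartAt Plane d x) := by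
  simp only [vectorDensity, (chartAt Plane c).left_inv hc, (chartAt Plane d).left_inv hd]
  rw [map_smul, ← components_transition c d X hc hd, density_transition g c d hc hd, mul_smul]

theorem divergence_eq_inv_mul_euclideanDiv (g : Metric M) (X : VField M) (x : M) :
    divergence g X x = (density g x (chartAt Plane x x))⁻¹ *
      euclideanDiv (vectorDensity g x X) (chartAt Plane x x) :=
  rfl

theorem divergence_eq_chart (g : Metric M) {X : VField M} (hX : IsC1Field X) (d : M) {x : M}
    (hd : x ∈ (chartAt Plane d).source) :
    divergence g X x = (density g d (chartAt Plane d x))⁻¹ *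
      euclideanDiv (vectorDensity g d X) (chartAt Plane d x) := by
  have hx := mem_chart_source Plane x
  have hτ := transition_chart x d hx
  obtain ⟨s, hs⟩ := exists_eventually_abs_det_transition_eq x d hx hd
  have hdet := det_fderiv_transition_ne_zero x d hx hd
  have hpiola : euclideanDiv (vectorDensity g x X) (chartAt Plane x x) = _ :=
    euclideanDiv_piola (τ := transition x d) (W' := fun z => s • vectorDensity g d X z)
      ((contDiffAt_transition x d hx hd).of_le ENat.LEInfty.out)
      (by rw [hτ]; exact (differentiableAt_vectorDensity g d hX hd).const_smul s)
      (by
        filter_upwards [eventually_exists_chart_eq x d hx hd] with z ⟨x', hx', hd', hz⟩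
        exact hz ▸ det_fderiv_transition_ne_zero x d hx' hd')
      (by
        filter_upwards [eventually_exists_chart_eq x d hx hd, hs] with z ⟨x', hx', hd', hz⟩ hsz
        rw [smul_smul, ← hsz, ← hz, transition_chart x d hx',
          fderiv_transition_vectorDensity g x d X hx' hd'])
  rw [divergence_eq_inv_mul_euclideanDiv, hpiola, euclideanDiv_const_smul, ← mul_assoc _ s,
    ← hs.self_of_nhds, hτ, density_transition g x d hx hd]
  field_simp [abs_ne_zero.2 hdet]

theorem continuous_divergence (g : Metric M) {X : VField M} (hX : IsC1Field X) :
    Continuous (divergence g X) := by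
  refine continuous_iff_continuousAt.2 fun c => ?_
  have hchart : divergence g X =ᶠ[𝓝 c] _ :=
    eventually_of_mem (chart_source_mem_nhds Plane c) fun x hx => divergence_eq_chart g hX c hx
  refine ContinuousAt.congr ?_ hchart.symm
  have he : ContinuousAt (chartAt Plane c) c :=
    (chartAt Plane c).continuousAt (mem_chart_source Plane c)
  have ht : (chartAt Plane c).target ∈ 𝓝 (chartAt Plane c c) := chart_target_mem_nhds Plane c
  refine ContinuousAt.mul (ContinuousAt.inv₀ ?_ (density_pos g c (mem_chart_target Plane c)).ne') ?_
  · exact ((contDiffOn_density g c).continuousOn.continuousAt ht).comp he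
  · refine tendsto_finsetSum _ fun i _ => ?_
    have hfderiv := ((contDiffOn_euclidean.1 (contDiffOn_vectorDensity g c hX)
      i).continuousOn_fderiv_of_isOpen (chartAt Plane c).open_target le_rfl).continuousAt ht
    exact (hfderiv.comp he).clm_apply continuousAt_const

theorem divergence_eq_zero_of_notMem (g : Metric M) {X : VField M} {K : Set M} (hK : IsClosed K)
    (hXK : ∀ x ∉ K, X x = 0) {x : M} (hx : x ∉ K) : divergence g X x = 0 := by
  have hsymm : ∀ᶠ z in 𝓝 (chartAt Plane x x), (chartAt Plane x).symm z ∉ K := by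
    refine ((chartAt Plane x).continuousAt_symm (mem_chart_target Plane x)).eventually
      (hK.isOpen_compl.mem_nhds ?_)
    rwa [(chartAt Plane x).left_inv (mem_chart_source Plane x)]
  have hzero : vectorDensity g x X =ᶠ[𝓝 (chartAt Plane x x)] fun _ => 0 := by
    filter_upwards [hsymm] with z hz
    have hcomponents : components x X ((chartAt Plane x).symm z) = 0 := by
      rw [components, hXK _ hz]
      exact map_zero (mfderiv (𝓡 2) (𝓡 2) (chartAt Plane x) ((chartAt Plane x).symm z))
    rw [vectorDensity, hcomponents, smul_zero]
  rw [divergence_eq_inv_mul_euclideanDiv, euclideanDiv_congr hzero]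
  simp [euclideanDiv]

end Divergence

section DirDeriv

variable {M : Type*} [TopologicalSpace M] [ChartedSpace Plane M]

/-- The derivative of the function `a` along the vector field `X`. -/
noncomputable def dirDeriv (a : M → ℝ) (X : VField M) (x : M) : ℝ :=
  mfderiv (𝓡 2) 𝓘(ℝ, ℝ) a x (X x)

theorem dirDeriv_congr {a b : M → ℝ} {x : M} (h : a =ᶠ[𝓝 x] b) (X : VField M) :
    dirDeriv a X x = dirDeriv b X x := by
  simp only [dirDeriv, h.mfderiv_eq]
  rfl

theorem dirDeriv_const (k : ℝ) (X : VField M) (x : M) : dirDeriv (fun _ => k) X x = 0 := by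
  simp only [dirDeriv, mfderiv_const]
  rfl

theorem dirDeriv_add {a b : M → ℝ} {x : M} (ha : MDifferentiableAt (𝓡 2) 𝓘(ℝ, ℝ) a x)
    (hb : MDifferentiableAt (𝓡 2) 𝓘(ℝ, ℝ) b x) (X : VField M) :
    dirDeriv (fun z => a z + b z) X x = dirDeriv a X x + dirDeriv b X x :=
  congrArg (fun l => l (X x)) (ha.hasMFDerivAt.add hb.hasMFDerivAt).mfderiv

theorem dirDeriv_mul {a b : M → ℝ} {x : M} (ha : MDifferentiableAt (𝓡 2) 𝓘(ℝ, ℝ) a x)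
    (hb : MDifferentiableAt (𝓡 2) 𝓘(ℝ, ℝ) b x) (X : VField M) :
    dirDeriv (fun z => a z * b z) X x = a x * dirDeriv b X x + b x * dirDeriv a X x :=
  congrArg (fun l => l (X x)) (ha.hasMFDerivAt.mul hb.hasMFDerivAt).mfderiv

theorem mdifferentiableAt_finset_sum {ι : Type*} (s : Finset ι) {a : ι → M → ℝ} {x : M}
    (ha : ∀ i ∈ s, MDifferentiableAt (𝓡 2) 𝓘(ℝ, ℝ) (a i) x) :
    MDifferentiableAt (𝓡 2) 𝓘(ℝ, ℝ) (fun z => ∑ i ∈ s, a i z) x := by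
  classical
  induction s using Finset.induction_on with
  | empty => exact mdifferentiableAt_const
  | insert i s hi ih =>
    simp only [Finset.sum_insert hi]
    exact (ha i (Finset.mem_insert_self i s)).add
      (ih fun j hj => ha j (Finset.mem_insert_of_mem hj))

theorem dirDeriv_sum {ι : Type*} (s : Finset ι) {a : ι → M → ℝ} {x : M}
    (ha : ∀ i ∈ s, MDifferentiableAt (𝓡 2) 𝓘(ℝ, ℝ) (a i) x) (X : VField M) :
    dirDeriv (fun z => ∑ i ∈ s, a i z) X x = ∑ i ∈ s, dirDeriv (a i) X x := by
  classical
  induction s using Finset.induction_on with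
  | empty => exact dirDeriv_const 0 X x
  | insert i s hi ih =>
    have hs (j : ι) (hj : j ∈ s) : MDifferentiableAt (𝓡 2) 𝓘(ℝ, ℝ) (a j) x :=
      ha j (Finset.mem_insert_of_mem hj)
    simp only [Finset.sum_insert hi]
    rw [dirDeriv_add (ha i (Finset.mem_insert_self i s)) (mdifferentiableAt_finset_sum s hs), ih hs]

theorem components_smul (c : M) (a : M → ℝ) (X : VField M) (x : M) :
    components c (fun z => a z • X z) x = a x • components c X x :=
  map_smul (mfderiv (𝓡 2) (𝓡 2) (chartAt Plane c) x) _ _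

variable [IsManifold (𝓡 2) ∞ M]

theorem IsC1Field.smul {X : VField M} (hX : IsC1Field X) {a : M → ℝ}
    (ha : ContMDiff (𝓡 2) 𝓘(ℝ, ℝ) 1 a) : IsC1Field (fun x => a x • X x) := by
  rw [isC1Field_iff] at hX ⊢
  intro c
  exact (((contMDiffOn_iff_contDiffOn_chart c a).1 ha.contMDiffOn).smul (hX c)).congr
    fun y _ => components_smul c a X _

theorem continuous_dirDeriv {X : VField M} (hX : IsC1Field X) {a : M → ℝ}
    (ha : ContMDiff (𝓡 2) 𝓘(ℝ, ℝ) 1 a) : Continuous (dirDeriv a X) := by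
  refine continuous_iff_continuousAt.2 fun c => ContinuousOn.continuousAt
    (s := (chartAt Plane c).source) ?_ (chart_source_mem_nhds Plane c)
  have hfderiv := ((contMDiffOn_iff_contDiffOn_chart c a).1
    ha.contMDiffOn).continuousOn_fderiv_of_isOpen (chartAt Plane c).open_target le_rfl
  exact ((hfderiv.comp (chartAt Plane c).continuousOn (chartAt Plane c).mapsTo).clm_apply
    (continuousOn_components c hX)).congr
    fun x hx => mfderiv_eq_fderiv_chart c hx (ha.mdifferentiableAt one_ne_zero) X

theorem inner_grad_eq_dirDeriv (g : Metric M) (f : M → ℝ) (X : VField M) (x : M) :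
    g.inner x (grad g f x) (X x) = dirDeriv f X x :=
  inner_grad g f x (X x)

theorem vectorDensity_smul (g : Metric M) (c : M) (a : M → ℝ) (X : VField M) (y : Plane) :
    vectorDensity g c (fun x => a x • X x) y =
      (a ∘ (chartAt Plane c).symm) y • vectorDensity g c X y := by
  rw [vectorDensity, components_smul, smul_comm]
  rfl

theorem divergence_smul (g : Metric M) {X : VField M} (hX : IsC1Field X) {a : M → ℝ} {x : M}
    (ha : MDifferentiableAt (𝓡 2) 𝓘(ℝ, ℝ) a x) :
    divergence g (fun z => a z • X z) x = a x * divergence g X x + dirDeriv a X x := by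
  have hx := mem_chart_source Plane x
  have hpos := density_pos g x (mem_chart_target Plane x)
  rw [divergence_eq_inv_mul_euclideanDiv, divergence_eq_inv_mul_euclideanDiv, dirDeriv,
    mfderiv_eq_fderiv_chart x hx ha X]
  simp only [funext (vectorDensity_smul g x a X)]
  rw [euclideanDiv_smul (differentiableAt_comp_chart_symm x hx ha)
    (differentiableAt_vectorDensity g x hX hx), vectorDensity, map_smul, Function.comp_apply,
    (chartAt Plane x).left_inv hx, smul_eq_mul]
  field_simp

end DirDeriv

section Volume

variable {M : Type*} [TopologicalSpace M] [ChartedSpace Plane M] [IsManifold (𝓡 2) ∞ M]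
  [MeasurableSpace M] [BorelSpace M]

omit [MeasurableSpace M] [BorelSpace M] in
theorem aemeasurable_density (g : Metric M) (c : M) :
    AEMeasurable (fun y => ENNReal.ofReal (density g c y))
      ((volume : Measure Plane).restrict (chartAt Plane c).target) :=
  ((contDiffOn_density g c).continuousOn.aemeasurable
    (chartAt Plane c).open_target.measurableSet).ennreal_ofReal

theorem aemeasurable_chart_symm (g : Metric M) (c : M) :
    AEMeasurable (chartAt Plane c).symm
      (((volume : Measure Plane).restrict (chartAt Plane c).target).withDensity
        fun y => ENNReal.ofReal (density g c y)) :=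
  ((chartAt Plane c).continuousOn_symm.aemeasurable
    (chartAt Plane c).open_target.measurableSet).mono_ac (withDensity_absolutelyContinuous _ _)

omit [IsManifold (𝓡 2) ∞ M] in
theorem measurableSet_image_chart (c : M) {A : Set M} (hA : MeasurableSet A)
    (hAc : A ⊆ (chartAt Plane c).source) : MeasurableSet (chartAt Plane c '' A) := by
  have hsymm : Measurable ((chartAt Plane c).target.domRestrict (chartAt Plane c).symm) :=
    (continuousOn_iff_continuous_domRestrict.1 (chartAt Plane c).continuousOn_symm).measurable
  have himage : chartAt Plane c '' A =
      Subtype.val '' ((chartAt Plane c).target.domRestrict (chartAt Plane c).symm ⁻¹' A) := by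
    rw [(chartAt Plane c).image_eq_target_inter_inv_preimage hAc]
    exact (Subtype.image_preimage_coe _ _).symm
  rw [himage]
  exact (chartAt Plane c).open_target.measurableSet.subtype_image (hsymm hA)

theorem chartVolume_apply (g : Metric M) (c : M) {A : Set M} (hA : MeasurableSet A)
    (hAc : A ⊆ (chartAt Plane c).source) :
    chartVolume g c A = ∫⁻ y in chartAt Plane c '' A, ENNReal.ofReal (density g c y) := by
  rw [chartVolume, Measure.map_apply_of_aemeasurable (aemeasurable_chart_symm g c) hA,
    withDensity_apply' _ _, Measure.restrict_restrict₀'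
      (chartAt Plane c).open_target.measurableSet.nullMeasurableSet, inter_comm,
    (chartAt Plane c).image_eq_target_inter_inv_preimage hAc]

theorem chartVolume_compl_source (g : Metric M) (c : M) :
    chartVolume g c (chartAt Plane c).sourceᶜ = 0 := by
  rw [chartVolume, Measure.map_apply_of_aemeasurable (aemeasurable_chart_symm g c)
    (chartAt Plane c).open_source.measurableSet.compl]
  refine withDensity_absolutelyContinuous _ _ ?_
  rw [Measure.restrict_apply' (chartAt Plane c).open_target.measurableSet]
  refine measure_mono_null (fun y hy => ?_) measure_empty
  exact hy.1 ((chartAt Plane c).map_target hy.2)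

theorem chartVolume_eq (g : Metric M) (c d : M) {A : Set M} (hA : MeasurableSet A)
    (hAc : A ⊆ (chartAt Plane c).source) (hAd : A ⊆ (chartAt Plane d).source) :
    chartVolume g c A = chartVolume g d A := by
  have himage : chartAt Plane d '' A = transition c d '' (chartAt Plane c '' A) := by
    rw [image_image]
    exact image_congr fun x hx => (transition_chart c d (hAc hx)).symm
  have hinj : InjOn (transition c d) (chartAt Plane c '' A) := by
    rintro _ ⟨x, hx, rfl⟩ _ ⟨x', hx', rfl⟩ h
    rw [transition_chart c d (hAc hx), transition_chart c d (hAc hx')] at h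
    rw [(chartAt Plane d).injOn (hAd hx) (hAd hx') h]
  rw [chartVolume_apply g c hA hAc, chartVolume_apply g d hA hAd, himage,
    lintegral_image_eq_lintegral_abs_det_fderiv_mul volume
      (measurableSet_image_chart c hA hAc) (f' := fderiv ℝ (transition c d)) ?_ hinj]
  · refine setLIntegral_congr_fun (measurableSet_image_chart c hA hAc) ?_
    rintro _ ⟨x, hx, rfl⟩
    simp only
    rw [density_transition g c d (hAc hx) (hAd hx), transition_chart c d (hAc hx),
      ENNReal.ofReal_mul (abs_nonneg _)]
  · rintro _ ⟨x, hx, rfl⟩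
    exact ((contDiffAt_transition c d (hAc hx) (hAd hx)).differentiableAt
      (by simp)).hasFDerivAt.hasFDerivWithinAt

variable [CompactSpace M] [Nonempty M]

theorem riemannianVolume_apply (g : Metric M) (c : M) {A : Set M} (hA : MeasurableSet A)
    (hAc : A ⊆ (chartAt Plane c).source) : riemannianVolume g A = chartVolume g c A := by
  set d := Classical.choose (exists_chart_cover M)
  have hcover : ⋃ n, (chartAt Plane (d n)).source = univ :=
    Classical.choose_spec (exists_chart_cover M)
  set D := disjointed (fun k => (chartAt Plane (d k)).source) with hD
  have hDmeas (n : ℕ) : MeasurableSet (D n) :=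
    MeasurableSet.disjointed (fun k => (chartAt Plane (d k)).open_source.measurableSet) n
  have hpiece (n : ℕ) : (chartVolume g (d n)).restrict (D n) A = chartVolume g c (A ∩ D n) := by
    rw [Measure.restrict_apply hA]
    exact chartVolume_eq g _ _ (hA.inter (hDmeas n))
      (inter_subset_right.trans (disjointed_subset _ n)) (inter_subset_left.trans hAc)
  change (Measure.sum fun n => (chartVolume g (d n)).restrict (D n)) A = _
  rw [Measure.sum_apply _ hA, tsum_congr hpiece, ← measure_iUnion, ← inter_iUnion, hD,
    iUnion_disjointed, hcover, inter_univ]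
  · exact fun i j hij =>
      (disjoint_disjointed _ hij).mono inter_subset_right inter_subset_right
  · exact fun n => hA.inter (hDmeas n)

theorem riemannianVolume_restrict_source (g : Metric M) (c : M) :
    (riemannianVolume g).restrict (chartAt Plane c).source = chartVolume g c := by
  ext A hA
  rw [Measure.restrict_apply hA, riemannianVolume_apply g c
    (hA.inter (chartAt Plane c).open_source.measurableSet) inter_subset_right]
  refine measure_congr (inter_ae_eq_left_of_ae_eq_univ ?_)
  rw [ae_eq_univ]
  exact chartVolume_compl_source g c

theorem exists_mem_nhds_riemannianVolume_lt_top (g : Metric M) (x : M) :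
    ∃ s ∈ 𝓝 x, riemannianVolume g s < ⊤ := by
  set e := chartAt Plane x
  obtain ⟨r, hr, hrt⟩ := Metric.nhds_basis_closedBall.mem_iff.1
    (e.open_target.mem_nhds (mem_chart_target Plane x))
  obtain ⟨C, hC⟩ := (isCompact_closedBall (e x) r).exists_bound_of_continuousOn
    ((contDiffOn_density g x).continuousOn.mono hrt)
  have hopen := e.isOpen_inter_preimage (Metric.isOpen_ball (x := e x) (ε := r))
  refine ⟨e.source ∩ e ⁻¹' Metric.ball (e x) r,
    hopen.mem_nhds ⟨mem_chart_source Plane x, Metric.mem_ball_self hr⟩, ?_⟩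
  rw [riemannianVolume_apply g x hopen.measurableSet inter_subset_left,
    chartVolume_apply g x hopen.measurableSet inter_subset_left]
  have himage : e '' (e.source ∩ e ⁻¹' Metric.ball (e x) r) ⊆ Metric.closedBall (e x) r :=
    image_subset_iff.2 fun z hz => Metric.ball_subset_closedBall hz.2
  calc ∫⁻ y in e '' (e.source ∩ e ⁻¹' Metric.ball (e x) r), ENNReal.ofReal (density g x y)
      ≤ ∫⁻ y in Metric.closedBall (e x) r, ENNReal.ofReal (density g x y) :=
        lintegral_mono_set himage
    _ ≤ ∫⁻ _ in Metric.closedBall (e x) r, ENNReal.ofReal C :=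
        setLIntegral_mono measurable_const fun y hy =>
          ENNReal.ofReal_le_ofReal ((le_abs_self _).trans (hC y hy))
    _ < ⊤ := by
        rw [setLIntegral_const]
        exact ENNReal.mul_lt_top ENNReal.ofReal_lt_top
          (isCompact_closedBall (e x) r).measure_lt_top

instance isFiniteMeasure_riemannianVolume (g : Metric M) :
    IsFiniteMeasure (riemannianVolume g) :=
  have : IsLocallyFiniteMeasure (riemannianVolume g) :=
    ⟨exists_mem_nhds_riemannianVolume_lt_top g⟩
  inferInstance

instance isOpenPosMeasure_riemannianVolume (g : Metric M) :
    (riemannianVolume g).IsOpenPosMeasure := by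
  refine ⟨fun U hU ⟨x, hx⟩ hU0 => ?_⟩
  set e := chartAt Plane x
  have hopen : IsOpen (U ∩ e.source) := hU.inter e.open_source
  have himage : IsOpen (e '' (U ∩ e.source)) := e.isOpen_image_of_subset_source hopen
    inter_subset_right
  have htarget : e '' (U ∩ e.source) ⊆ e.target :=
    image_subset_iff.2 fun z hz => e.map_source hz.2
  have hnull : riemannianVolume g (U ∩ e.source) = 0 := measure_mono_null inter_subset_left hU0
  rw [riemannianVolume_apply g x hopen.measurableSet inter_subset_right,
    chartVolume_apply g x hopen.measurableSet inter_subset_right,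
    setLIntegral_eq_zero_iff' himage.measurableSet
      ((aemeasurable_density g x).mono_measure (Measure.restrict_mono htarget le_rfl))] at hnull
  refine himage.measure_ne_zero volume ⟨e x, x, ⟨hx, mem_chart_source Plane x⟩, rfl⟩
    (measure_eq_zero_iff_ae_notMem.2 (hnull.mono fun y hy hmem => ?_))
  exact (ENNReal.ofReal_eq_zero.1 (hy hmem)).not_gt (density_pos g x (htarget hmem))

theorem integral_eq_integral_chart (g : Metric M) (c : M) {h : M → ℝ} (hh : Continuous h)
    (hsupp : ∀ x ∉ (chartAt Plane c).source, h x = 0) :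
    ∫ x, h x ∂(riemannianVolume g) = ∫ y in (chartAt Plane c).target,
      density g c y * h ((chartAt Plane c).symm y) := by
  rw [← setIntegral_eq_integral_of_forall_compl_eq_zero hsupp, riemannianVolume_restrict_source,
    chartVolume, integral_map (aemeasurable_chart_symm g c) hh.aestronglyMeasurable,
    integral_withDensity_eq_integral_toReal_smul₀ (aemeasurable_density g c)
      (Eventually.of_forall fun _ => ENNReal.ofReal_lt_top)]
  refine setIntegral_congr_fun (chartAt Plane c).open_target.measurableSet fun y hy => ?_
  simp only [smul_eq_mul, ENNReal.toReal_ofReal (density_pos g c hy).le]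

end Volume

section DivergenceTheorem

theorem integral_fderiv_eq_zero {E : Type*} [NormedAddCommGroup E] [NormedSpace ℝ E]
    [FiniteDimensional ℝ E] [MeasurableSpace E] [BorelSpace E] (μ : Measure E)
    [μ.IsAddHaarMeasure] {w : E → ℝ} (hw : ContDiff ℝ 1 w) (hc : HasCompactSupport w) (v : E) :
    ∫ y, fderiv ℝ w y v ∂μ = 0 := by
  have hderiv : Continuous fun y => fderiv ℝ w y v :=
    (hw.continuous_fderiv one_ne_zero).clm_apply continuous_const
  simpa using integral_mul_fderiv_eq_neg_fderiv_mul_of_integrable (μ := μ)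
    (f := fun _ => (1 : ℝ)) (g := w) (v := v) (by simp)
    (by simpa using hderiv.integrable_of_hasCompactSupport (hc.fderiv_apply ℝ v))
    (by simpa using hw.continuous.integrable_of_hasCompactSupport hc) (by simp)
    (fun x _ => hw.differentiable one_ne_zero x)

theorem integral_euclideanDiv_eq_zero {ι : Type*} [Fintype ι] [DecidableEq ι]
    {W : EuclideanSpace ℝ ι → EuclideanSpace ℝ ι} (hW : ContDiff ℝ 1 W)
    (hc : HasCompactSupport W) : ∫ y, euclideanDiv W y = 0 := by
  have hWi (i : ι) : ContDiff ℝ 1 fun y => W y i := contDiff_euclidean.1 hW i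
  have hci (i : ι) : HasCompactSupport fun y => W y i :=
    hc.comp_left (g := fun v : EuclideanSpace ℝ ι => v i) rfl
  simp only [euclideanDiv]
  rw [integral_finsetSum]
  · exact Finset.sum_eq_zero fun i _ => integral_fderiv_eq_zero volume (hWi i) (hci i) _
  · exact fun i _ => (((hWi i).continuous_fderiv one_ne_zero).clm_apply
      continuous_const).integrable_of_hasCompactSupport ((hci i).fderiv_apply ℝ _)

theorem contDiff_indicator {E G : Type*} [NormedAddCommGroup E] [NormedSpace ℝ E]
    [NormedAddCommGroup G] [NormedSpace ℝ G] {n : ℕ∞ω} {U K : Set E} {w : E → G} (hU : IsOpen U)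
    (hK : IsClosed K) (hKU : K ⊆ U) (hw : ContDiffOn ℝ n w U) (hwK : ∀ y ∈ U \ K, w y = 0) :
    ContDiff ℝ n (U.indicator w) := by
  refine contDiff_iff_contDiffAt.2 fun y => ?_
  by_cases hy : y ∈ U
  · exact (hw.contDiffAt (hU.mem_nhds hy)).congr_of_eventuallyEq
      (eqOn_indicator.eventuallyEq_of_mem (hU.mem_nhds hy))
  · refine contDiffAt_const (c := 0) |>.congr_of_eventuallyEq ?_
    filter_upwards [hK.isOpen_compl.mem_nhds fun hyK => hy (hKU hyK)] with z hz
    exact indicator_apply_eq_zero.2 fun hzU => hwK z ⟨hzU, hz⟩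

variable {M : Type*} [TopologicalSpace M] [ChartedSpace Plane M] [IsManifold (𝓡 2) ∞ M]

theorem exists_partition_of_unity [CompactSpace M] [T2Space M] (U : M → Set M)
    (hU : ∀ x, IsOpen (U x)) (hxU : ∀ x, x ∈ U x) :
    ∃ (s : Finset M) (ψ : M → M → ℝ), (∀ i, ContMDiff (𝓡 2) 𝓘(ℝ, ℝ) ∞ (ψ i)) ∧
      (∀ i x, ψ i x ∈ Icc 0 1) ∧ (∀ i, tsupport (ψ i) ⊆ U i) ∧ ∀ x, ∑ i ∈ s, ψ i x = 1 := by
  obtain ⟨p, hp⟩ := SmoothPartitionOfUnity.exists_isSubordinate (𝓡 2) isClosed_univ U hU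
    fun x _ => mem_iUnion.2 ⟨x, hxU x⟩
  refine ⟨p.locallyFinite.finite_nonempty_of_compact.toFinset, fun i => p i,
    fun i => (p i).contMDiff, fun i x => ⟨p.nonneg i x, p.le_one i x⟩, hp, fun x => ?_⟩
  rw [← p.sum_eq_one (mem_univ x), finsum_eq_sum_of_support_subset]
  exact fun i hi => (Finite.mem_toFinset _).2 ⟨x, hi⟩

variable [CompactSpace M] [T2Space M] [Nonempty M] [MeasurableSpace M] [BorelSpace M]

theorem integral_divergence_of_subset_source (g : Metric M) (c : M) {X : VField M}
    (hX : IsC1Field X) {K : Set M} (hK : IsCompact K) (hKc : K ⊆ (chartAt Plane c).source)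
    (hXK : ∀ x ∉ K, X x = 0) : ∫ x, divergence g X x ∂(riemannianVolume g) = 0 := by
  set e := chartAt Plane c
  have hKt : e '' K ⊆ e.target := image_subset_iff.2 fun x hx => e.map_source (hKc hx)
  have hKe : IsCompact (e '' K) := hK.image_of_continuousOn (e.continuousOn.mono hKc)
  set W := e.target.indicator (vectorDensity g c X)
  have hvanish : ∀ y ∈ e.target \ e '' K, vectorDensity g c X y = 0 := by
    intro y hy
    have hcomponents : components c X (e.symm y) = 0 := by
      rw [components, hXK _ fun hmem => hy.2 ⟨_, hmem, e.right_inv hy.1⟩]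
      exact map_zero (mfderiv (𝓡 2) (𝓡 2) e (e.symm y))
    rw [vectorDensity, hcomponents, smul_zero]
  have hW : ContDiff ℝ 1 W :=
    contDiff_indicator e.open_target hKe.isClosed hKt (contDiffOn_vectorDensity g c hX) hvanish
  have hWK (y : Plane) (hy : y ∉ e '' K) : W y = 0 :=
    indicator_apply_eq_zero.2 fun hyt => hvanish y ⟨hyt, hy⟩
  have hdiv : ∀ y ∈ e.target,
      density g c y * divergence g X (e.symm y) = euclideanDiv W y := by
    intro y hy
    rw [divergence_eq_chart g hX c (e.map_target hy), e.right_inv hy,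
      mul_inv_cancel_left₀ (density_pos g c hy).ne']
    exact euclideanDiv_congr (eqOn_indicator.symm.eventuallyEq_of_mem (e.open_target.mem_nhds hy))
  have hdivW (y : Plane) (hy : y ∉ e.target) : euclideanDiv W y = 0 := by
    have hW0 : W =ᶠ[𝓝 y] fun _ => 0 := eventually_of_mem
      (hKe.isClosed.isOpen_compl.mem_nhds fun hmem => hy (hKt hmem)) hWK
    rw [euclideanDiv_congr hW0]
    simp [euclideanDiv]
  rw [integral_eq_integral_chart g c (continuous_divergence g hX) fun x hx =>
      divergence_eq_zero_of_notMem g hK.isClosed hXK fun hxK => hx (hKc hxK),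
    setIntegral_congr_fun e.open_target.measurableSet hdiv,
    setIntegral_eq_integral_of_forall_compl_eq_zero hdivW]
  exact integral_euclideanDiv_eq_zero hW (HasCompactSupport.intro hKe hWK)

theorem integral_divergence (g : Metric M) {X : VField M} (hX : IsC1Field X) :
    ∫ x, divergence g X x ∂(riemannianVolume g) = 0 := by
  obtain ⟨s, ψ, hψ, -, hsub, hsum⟩ := exists_partition_of_unity
    (fun c : M => (chartAt Plane c).source) (fun c => (chartAt Plane c).open_source)
    (fun c => mem_chart_source Plane c)
  have hψ1 (i : M) : ContMDiff (𝓡 2) 𝓘(ℝ, ℝ) 1 (ψ i) := (hψ i).of_le ENat.LEInfty.out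
  have hψd (i x : M) : MDifferentiableAt (𝓡 2) 𝓘(ℝ, ℝ) (ψ i) x :=
    (hψ1 i).mdifferentiableAt one_ne_zero
  have hdecomp (x : M) :
      divergence g X x = ∑ i ∈ s, divergence g (fun z => ψ i z • X z) x := by
    have hderiv : ∑ i ∈ s, dirDeriv (ψ i) X x = 0 := by
      rw [← dirDeriv_sum s fun i _ => hψd i x, funext hsum]
      exact dirDeriv_const 1 X x
    rw [Finset.sum_congr rfl fun i _ => divergence_smul g hX (hψd i x), Finset.sum_add_distrib,
      hderiv, ← Finset.sum_mul, hsum, one_mul, add_zero]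
  simp only [hdecomp]
  rw [integral_finsetSum]
  · refine Finset.sum_eq_zero fun i _ => ?_
    refine integral_divergence_of_subset_source g i (hX.smul (hψ1 i))
      (isClosed_tsupport (ψ i)).isCompact (hsub i) fun x hx => ?_
    rw [image_eq_zero_of_notMem_tsupport hx]
    exact zero_smul ℝ (X x)
  · exact fun i _ => (continuous_divergence g (hX.smul (hψ1 i))).integrable_of_hasCompactSupport
      (HasCompactSupport.of_compactSpace _)

end DivergenceTheorem

section Cutoff

theorem deriv_le_of_forall_le {s : ℝ → ℝ} {s' D C T : ℝ} (hT : 0 < T) (hs : HasDerivAt s s' 0)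
    (h : ∀ t, 0 < t → t < T → s t ≤ s 0 + t * D + C * t ^ 2) : s' ≤ D := by
  have hbound : Tendsto (fun t : ℝ => D + C * t) (𝓝[>] 0) (𝓝 D) := by
    have hcont : Continuous fun t : ℝ => D + C * t := by fun_prop
    simpa using (hcont.tendsto 0).mono_left nhdsWithin_le_nhds
  refine le_of_tendsto_of_tendsto hs.tendsto_slope_zero_right hbound ?_
  filter_upwards [Ioo_mem_nhdsGT hT] with t ht
  rw [zero_add, smul_eq_mul, inv_mul_le_iff₀ ht.1]
  linarith [h t ht.1 ht.2]

theorem abs_deriv_le_of_forall_le {s : ℝ → ℝ} {s' D C T : ℝ} (hT : 0 < T) (hs : HasDerivAt s s' 0)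
    (h : ∀ t, |t| < T → s t ≤ s 0 + |t| * D + C * t ^ 2) : |s'| ≤ D := by
  refine abs_le'.2 ⟨deriv_le_of_forall_le hT hs (C := C) fun t hpos ht => ?_,
    deriv_le_of_forall_le (s := fun t => s (-t)) hT ?_ (C := C) fun t hpos ht => ?_⟩
  · simpa [abs_of_pos hpos] using h t (by rwa [abs_of_pos hpos])
  · have hs' : HasDerivAt s s' (-0) := by rwa [neg_zero]
    simpa [Function.comp_def] using hs'.comp (0 : ℝ) (hasDerivAt_neg (0 : ℝ))
  · simpa [abs_of_pos hpos] using h (-t) (by rwa [abs_neg, abs_of_pos hpos])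

variable {E : Type*} [NormedAddCommGroup E] [NormedSpace ℝ E]

/-- The vector field `F` is tangent to the set `Z`, to second order and uniformly on `U`: an Euler
step of length `t`, of either sign, from a point of `Z ∩ U` ends within `C * t ^ 2` of `Z`. -/
def IsTangentOn (F : E → E) (Z U : Set E) : Prop :=
  ∃ C, ∃ T > 0, ∀ z ∈ Z ∩ U, ∀ t, |t| < T → ∃ w ∈ Z, ‖w - (z + t • F z)‖ ≤ C * t ^ 2

theorem IsTangentOn.exists_infDist_add_smul_le [ProperSpace E] {F : E → E} {Z U : Set E}
    {K : NNReal} (h : IsTangentOn F Z U) (hZ : IsClosed Z) (hZne : Z.Nonempty)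
    (hF : LipschitzWith K F) :
    ∃ C, ∃ T > 0, ∀ x y, Metric.closedBall y (Metric.infDist y Z) ⊆ U → ∀ t, |t| < T →
      Metric.infDist (y + t • F x) Z ≤
        Metric.infDist y Z + |t| * (K * (dist x y + Metric.infDist y Z)) + C * t ^ 2 := by
  obtain ⟨C, T, hT, hZU⟩ := h
  refine ⟨C, T, hT, fun x y hyU t ht => ?_⟩
  obtain ⟨z, hz, hyz⟩ := hZ.exists_infDist_eq_dist hZne y
  obtain ⟨w, hw, hwz⟩ := hZU z ⟨hz, hyU (by rw [Metric.mem_closedBall, dist_comm, hyz])⟩ t ht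
  have hxz : dist (F x) (F z) ≤ K * (dist x y + dist y z) :=
    (hF.dist_le_mul x z).trans (by gcongr; exact dist_triangle x y z)
  calc Metric.infDist (y + t • F x) Z ≤ dist (y + t • F x) w := Metric.infDist_le_dist_of_mem hw
    _ = ‖(y - z) + t • (F x - F z) - (w - (z + t • F z))‖ := by
      rw [dist_eq_norm, smul_sub]; congr 1; abel
    _ ≤ ‖y - z‖ + ‖t • (F x - F z)‖ + ‖w - (z + t • F z)‖ :=
      (norm_sub_le _ _).trans (by gcongr; exact norm_add_le _ _)
    _ ≤ Metric.infDist y Z + |t| * (K * (dist x y + Metric.infDist y Z)) + C * t ^ 2 := by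
      rw [norm_smul, Real.norm_eq_abs, ← dist_eq_norm, ← dist_eq_norm, hyz]
      gcongr

variable [FiniteDimensional ℝ E]

open scoped Convolution in
theorem abs_fderiv_normed_convolution_le [MeasurableSpace E] [BorelSpace E] (μ : Measure E)
    [μ.IsAddHaarMeasure] (φ : ContDiffBump (0 : E)) {d : E → ℝ} (hd : Continuous d) {x v : E}
    {D C T : ℝ} (hT : 0 < T)
    (h : ∀ y ∈ Metric.ball 0 φ.rOut, ∀ t, |t| < T →
      d (x - y + t • v) ≤ d (x - y) + |t| * D + C * t ^ 2) :
    |fderiv ℝ (φ.normed μ ⋆[ContinuousLinearMap.lsmul ℝ ℝ, μ] d) x v| ≤ D := by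
  set u := φ.normed μ ⋆[ContinuousLinearMap.lsmul ℝ ℝ, μ] d
  have hu : ContDiff ℝ 1 u := φ.hasCompactSupport_normed.contDiff_convolution_left _
    φ.contDiff_normed hd.locallyIntegrable
  have hu_apply : ∀ x, u x = ∫ y, φ.normed μ y * d (x - y) ∂μ := fun _ => rfl
  have hint : ∀ x, Integrable (fun y => φ.normed μ y * d (x - y)) μ := fun x =>
    Continuous.integrable_of_hasCompactSupport
      (φ.continuous_normed.mul (hd.comp (continuous_const.sub continuous_id)))
      φ.hasCompactSupport_normed.mul_right
  have hline : HasDerivAt (fun t : ℝ => x + t • v) v 0 := by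
    simpa using ((hasDerivAt_id (0 : ℝ)).smul_const v).const_add x
  have hderiv : HasDerivAt (fun t : ℝ => u (x + t • v)) (fderiv ℝ u x v) 0 := by
    have hfderiv : HasFDerivAt u (fderiv ℝ u x) (x + (0 : ℝ) • v) := by
      simpa using (hu.differentiable one_ne_zero x).hasFDerivAt
    exact hfderiv.comp_hasDerivAt (0 : ℝ) hline
  refine abs_deriv_le_of_forall_le (C := C) hT hderiv fun t ht => ?_
  have hmean : ∫ y, φ.normed μ y * (|t| * D + C * t ^ 2) ∂μ = |t| * D + C * t ^ 2 := by
    rw [integral_mul_const, φ.integral_normed, one_mul]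
  rw [zero_smul, add_zero, hu_apply, hu_apply, add_assoc, ← hmean,
    ← integral_add (hint x) (φ.integrable_normed.mul_const _)]
  refine integral_mono (hint _) ((hint x).add (φ.integrable_normed.mul_const _)) fun y => ?_
  simp only [← mul_add]
  by_cases hy : y ∈ Metric.ball (0 : E) φ.rOut
  · rw [add_sub_right_comm, ← add_assoc]
    exact mul_le_mul_of_nonneg_left (h y hy t ht) (φ.nonneg_normed y)
  · have hzero : φ.normed μ y = 0 := by
      rwa [← Function.notMem_support, φ.support_normed_eq]
    simp [hzero]

open scoped Convolution in
theorem IsTangentOn.exists_smooth_infDist {F : E → E} {Z U : Set E} {K : NNReal}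
    (h : IsTangentOn F Z U) (hZ : IsClosed Z) (hZne : Z.Nonempty) (hF : LipschitzWith K F)
    {δ : ℝ} (hδ : 0 < δ) :
    ∃ u : E → ℝ, ContDiff ℝ ∞ u ∧ (∀ x, |u x - Metric.infDist x Z| ≤ δ) ∧
      ∀ x, Metric.closedBall x (Metric.infDist x Z + 2 * δ) ⊆ U →
        |fderiv ℝ u x (F x)| ≤ K * (Metric.infDist x Z + 2 * δ) := by
  borelize E
  let μ : Measure E := Measure.addHaar
  let φ : ContDiffBump (0 : E) := ⟨δ / 2, δ, half_pos hδ, half_lt_self hδ⟩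
  have hcont : Continuous fun x => Metric.infDist x Z := Metric.continuous_infDist_pt Z
  obtain ⟨C, T, hT, hgrowth⟩ := h.exists_infDist_add_smul_le hZ hZne hF
  refine ⟨φ.normed μ ⋆[ContinuousLinearMap.lsmul ℝ ℝ, μ] fun x => Metric.infDist x Z,
    φ.hasCompactSupport_normed.contDiff_convolution_left _ φ.contDiff_normed
      hcont.locallyIntegrable, fun x => ?_, fun x hxU => ?_⟩
  · refine φ.dist_normed_convolution_le hcont.aestronglyMeasurable fun y hy => ?_
    simpa using ((Metric.lipschitz_infDist_pt Z).dist_le_mul y x).trans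
      (by simpa using (Metric.mem_ball.1 hy).le)
  · refine abs_fderiv_normed_convolution_le μ φ hcont hT (C := C) fun y hy t ht => ?_
    have hy : dist x (x - y) < δ := by simpa using hy
    have hdist : Metric.infDist (x - y) Z ≤ Metric.infDist x Z + dist x (x - y) := by
      rw [dist_comm]; exact Metric.infDist_le_infDist_add_dist
    have hball : Metric.closedBall (x - y) (Metric.infDist (x - y) Z) ⊆ U :=
      (Metric.closedBall_subset_closedBall' (by rw [dist_comm]; linarith)).trans hxU
    refine (hgrowth x (x - y) hball t ht).trans ?_
    gcongr _ + |t| * (K * ?_) + _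
    linarith

theorem deriv_smoothTransition_of_one_lt {s : ℝ} (hs : 1 < s) :
    deriv Real.smoothTransition s = 0 := by
  have heq : Real.smoothTransition =ᶠ[𝓝 s] fun _ => 1 := by
    filter_upwards [lt_mem_nhds hs] with z hz using Real.smoothTransition.one_of_one_le hz.le
  rw [heq.deriv_eq, deriv_const]

theorem deriv_smoothTransition_of_neg {s : ℝ} (hs : s < 0) :
    deriv Real.smoothTransition s = 0 := by
  have heq : Real.smoothTransition =ᶠ[𝓝 s] fun _ => 0 := by
    filter_upwards [gt_mem_nhds hs] with z hz using Real.smoothTransition.zero_of_nonpos hz.le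
  rw [heq.deriv_eq, deriv_const]

theorem exists_abs_deriv_smoothTransition_le : ∃ B, ∀ s, |deriv Real.smoothTransition s| ≤ B := by
  have hcont : Continuous (deriv Real.smoothTransition) :=
    (Real.smoothTransition.contDiff (n := 1)).continuous_deriv le_rfl
  refine hcont.bounded_above_of_compact_support
    (HasCompactSupport.intro (isCompact_Icc (a := (0 : ℝ)) (b := 1)) fun s hs => ?_)
  rw [mem_Icc, not_and_or, not_le, not_le] at hs
  exact hs.elim deriv_smoothTransition_of_neg deriv_smoothTransition_of_one_lt

omit [FiniteDimensional ℝ E] in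
theorem hasFDerivAt_smoothTransition_comp {u : E → ℝ} {u' : E →L[ℝ] ℝ} {x : E}
    (hu : HasFDerivAt u u' x) :
    HasFDerivAt (fun z => Real.smoothTransition (u z)) (deriv Real.smoothTransition (u x) • u') x :=
  ((Real.smoothTransition.contDiff (n := 1)).differentiable one_ne_zero _).hasDerivAt
    |>.comp_hasFDerivAt x hu

theorem IsTangentOn.exists_cutoff {F : E → E} {Z U : Set E} {K : NNReal}
    (h : IsTangentOn F Z U) (hZ : IsClosed Z) (hZne : Z.Nonempty) (hF : LipschitzWith K F) :
    ∃ B, ∀ δ > 0, ∃ χ : E → ℝ, ContDiff ℝ ∞ χ ∧ (∀ x, χ x ∈ Icc 0 1) ∧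
      (∀ x, χ x ≠ 0 → δ ≤ Metric.infDist x Z) ∧ (∀ x, 4 * δ < Metric.infDist x Z → χ x = 1) ∧
      ∀ x, Metric.closedBall x (6 * δ) ⊆ U → |fderiv ℝ χ x (F x)| ≤ B := by
  obtain ⟨B, hB⟩ := exists_abs_deriv_smoothTransition_le
  have hB_nonneg : 0 ≤ B := (abs_nonneg _).trans (hB 0)
  refine ⟨B * (6 * K), fun δ hδ => ?_⟩
  obtain ⟨u, husmooth, hudist, hufderiv⟩ := h.exists_smooth_infDist hZ hZne hF hδ
  refine ⟨fun x => Real.smoothTransition ((u x - 2 * δ) / δ),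
    Real.smoothTransition.contDiff.comp ((husmooth.sub contDiff_const).div_const _),
    fun x => ⟨Real.smoothTransition.nonneg _, Real.smoothTransition.le_one _⟩,
    fun x hx => ?_, fun x hx => ?_, fun x hxU => ?_⟩
  · by_contra! hlt
    refine hx (Real.smoothTransition.zero_of_nonpos (div_nonpos_of_nonpos_of_nonneg ?_ hδ.le))
    linarith [(abs_le.1 (hudist x)).2]
  · refine Real.smoothTransition.one_of_one_le ((one_le_div hδ).2 ?_)
    linarith [(abs_le.1 (hudist x)).1]
  · have hinner : HasFDerivAt (fun x => (u x - 2 * δ) / δ) (δ⁻¹ • fderiv ℝ u x) x := by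
      simpa only [div_eq_inv_mul] using
        ((husmooth.differentiable (by simp) x).hasFDerivAt.sub_const (2 * δ)).const_mul δ⁻¹
    rw [(hasFDerivAt_smoothTransition_comp hinner).fderiv]
    simp only [smul_apply, smul_eq_mul, abs_mul]
    rcases lt_or_ge (4 * δ) (Metric.infDist x Z) with hfar | hnear
    · have hlarge : 1 < (u x - 2 * δ) / δ := by
        rw [one_lt_div hδ]
        linarith [(abs_le.1 (hudist x)).1]
      rw [deriv_smoothTransition_of_one_lt hlarge, abs_zero, zero_mul]
      positivity
    · have hball : Metric.closedBall x (Metric.infDist x Z + 2 * δ) ⊆ U :=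
        (Metric.closedBall_subset_closedBall (by linarith)).trans hxU
      have hslope : |δ⁻¹| * |fderiv ℝ u x (F x)| ≤ 6 * K := by
        rw [abs_of_pos (inv_pos.2 hδ), inv_mul_le_iff₀ hδ]
        calc |fderiv ℝ u x (F x)| ≤ K * (Metric.infDist x Z + 2 * δ) := hufderiv x hball
          _ ≤ K * (4 * δ + 2 * δ) := by gcongr
          _ = δ * (6 * K) := by ring
      exact mul_le_mul (hB _) hslope (by positivity) hB_nonneg

theorem IsTangentOn.exists_seq_cutoff {F : E → E} {Z U : Set E} {K : NNReal}
    (h : IsTangentOn F Z U) (hZ : IsClosed Z) (hZne : Z.Nonempty) (hF : LipschitzWith K F)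
    {r : ℝ} (hr : 0 < r) :
    ∃ (χ : ℕ → E → ℝ) (B : ℝ), (∀ n, ContDiff ℝ ∞ (χ n)) ∧ (∀ n x, χ n x ∈ Icc 0 1) ∧
      (∀ n, tsupport (χ n) ⊆ Zᶜ) ∧ (∀ x ∉ Z, ∀ᶠ n in atTop, χ n =ᶠ[𝓝 x] fun _ => 1) ∧
      ∀ n x, Metric.closedBall x r ⊆ U → |fderiv ℝ (χ n) x (F x)| ≤ B := by
  obtain ⟨δ, -, hδ, hδlim⟩ := exists_seq_strictAnti_tendsto' (x := (0 : ℝ)) (y := r / 6)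
    (by positivity)
  obtain ⟨B, hB⟩ := h.exists_cutoff hZ hZne hF
  choose χ hsmooth hIcc hsupp hone hderiv using fun n => hB (δ n) (hδ n).1
  have hinfDist : Continuous fun x => Metric.infDist x Z := Metric.continuous_infDist_pt Z
  refine ⟨χ, B, hsmooth, hIcc, fun n x hx hxZ => ?_, fun x hx => ?_, fun n x hxU =>
    hderiv n x ((Metric.closedBall_subset_closedBall (by linarith [(hδ n).2])).trans hxU)⟩
  · have hfar : x ∈ {x | δ n ≤ Metric.infDist x Z} :=
      closure_minimal (hsupp n) (isClosed_le continuous_const hinfDist) hx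
    rw [mem_ofPred_eq, Metric.infDist_zero_of_mem hxZ] at hfar
    exact hfar.not_gt (hδ n).1
  · have hlim : Tendsto (fun n => 4 * δ n) atTop (𝓝 0) := by simpa using hδlim.const_mul 4
    filter_upwards [hlim.eventually (gt_mem_nhds ((hZ.notMem_iff_infDist_pos hZne).1 hx))] with n hn
    filter_upwards [hinfDist.continuousAt.eventually (lt_mem_nhds hn)] with z hz using hone n z hz

end Cutoff

section Euler

variable {E : Type*} [NormedAddCommGroup E] [NormedSpace ℝ E] {F : E → E} {K : NNReal} {A T : ℝ}

theorem norm_curve_sub_le {γ : ℝ → E} (hγ : ∀ t ∈ Ioo (-T) T, HasDerivAt γ (F (γ t)) t)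
    (hA : ∀ x, ‖F x‖ ≤ A) {t : ℝ} (ht : |t| < T) : ‖γ t - γ 0‖ ≤ A * |t| := by
  have hT : 0 < T := (abs_nonneg t).trans_lt ht
  simpa using (convex_Ioo (-T) T).norm_image_sub_le_of_norm_hasDerivWithin_le
    (fun s hs => (hγ s hs).hasDerivWithinAt) (fun s _ => hA (γ s)) ⟨neg_lt_zero.2 hT, hT⟩
    (abs_lt.1 ht)

theorem norm_curve_sub_euler_step_le {γ : ℝ → E}
    (hγ : ∀ t ∈ Ioo (-T) T, HasDerivAt γ (F (γ t)) t) (hF : LipschitzWith K F)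
    (hA : ∀ x, ‖F x‖ ≤ A) {t : ℝ} (ht : |t| < T) :
    ‖γ t - (γ 0 + t • F (γ 0))‖ ≤ K * A * t ^ 2 := by
  have hmem : ∀ s ∈ Icc (-|t|) |t|, |s| < T := fun s hs => (abs_le.2 hs).trans_lt ht
  have hderiv : ∀ s ∈ Icc (-|t|) |t|, HasDerivWithinAt (fun s => γ s - s • F (γ 0))
      (F (γ s) - F (γ 0)) (Icc (-|t|) |t|) s := fun s hs => by
    simpa using ((hγ s (abs_lt.1 (hmem s hs))).fun_sub
      ((hasDerivAt_id' s).smul_const (F (γ 0)))).hasDerivWithinAt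
  have hbound : ∀ s ∈ Icc (-|t|) |t|, ‖F (γ s) - F (γ 0)‖ ≤ K * (A * |t|) := fun s hs => by
    have hA_nonneg : 0 ≤ A := (norm_nonneg _).trans (hA 0)
    refine (hF.norm_sub_le _ _).trans ?_
    gcongr
    exact (norm_curve_sub_le hγ hA (hmem s hs)).trans
      (mul_le_mul_of_nonneg_left (abs_le.2 hs) hA_nonneg)
  calc ‖γ t - (γ 0 + t • F (γ 0))‖ = ‖γ t - t • F (γ 0) - (γ 0 - (0 : ℝ) • F (γ 0))‖ := by
        congr 1; rw [zero_smul, sub_zero]; abel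
    _ ≤ K * (A * |t|) * ‖t - 0‖ :=
      (convex_Icc (-|t|) |t|).norm_image_sub_le_of_norm_hasDerivWithin_le hderiv hbound
        ⟨by simp, by simp⟩ ⟨neg_abs_le t, le_abs_self t⟩
    _ = K * A * t ^ 2 := by rw [sub_zero, Real.norm_eq_abs, ← sq_abs t]; ring

theorem isTangentOn_of_integral_curves {Z U : Set E} (hF : LipschitzWith K F)
    (hA : ∀ x, ‖F x‖ ≤ A) (hT : 0 < T)
    (h : ∀ z ∈ Z ∩ U, ∃ γ : ℝ → E, γ 0 = z ∧
      ∀ t ∈ Ioo (-T) T, HasDerivAt γ (F (γ t)) t ∧ γ t ∈ Z) : IsTangentOn F Z U := by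
  refine ⟨K * A, T, hT, fun z hz t ht => ?_⟩
  obtain ⟨γ, rfl, hγ⟩ := h z hz
  exact ⟨γ t, (hγ t (abs_lt.1 ht)).2,
    norm_curve_sub_euler_step_le (fun s hs => (hγ s hs).1) hF hA ht⟩

theorem exists_local_flow [CompleteSpace E] (hF : LipschitzWith K F) (hA : ∀ x, ‖F x‖ ≤ A)
    (x₀ : E) {R : ℝ} (hR : 0 < R) :
    ∃ T > 0, ∃ α : E → ℝ → E, (∀ z ∈ Metric.ball x₀ R, α z 0 = z) ∧
      (∀ z ∈ Metric.ball x₀ R, ∀ t ∈ Ioo (-T) T,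
        α z t ∈ Metric.ball x₀ (2 * R) ∧ HasDerivAt (α z) (F (α z t)) t) ∧
      ∀ t ∈ Ioo (-T) T, ContinuousOn (fun z => α z t) (Metric.ball x₀ R) := by
  have hA_nonneg : 0 ≤ A := (norm_nonneg _).trans (hA 0)
  set T := R / (A + 1) with hT_def
  have hT : 0 < T := by positivity
  have hAT : A * T ≤ R := by
    rw [hT_def, ← mul_div_assoc, div_le_iff₀ (by positivity)]
    nlinarith
  have hPL : IsPicardLindelof (fun _ => F) (tmin := -T) (tmax := T) ⟨0, by linarith, hT.le⟩ x₀
      ⟨2 * R, by positivity⟩ ⟨R, hR.le⟩ ⟨A, hA_nonneg⟩ K := by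
    refine .of_time_independent (fun x _ => hA x) hF.lipschitzOnWith ?_
    simp only [sub_zero, zero_sub, neg_neg, max_self]
    change A * T ≤ 2 * R - R
    linarith
  obtain ⟨α, hα, _, hlip⟩ := hPL.exists_forall_mem_closedBall_eq_hasDerivWithinAt_lipschitzOnWith
  have hzero : ∀ z ∈ Metric.ball x₀ R, α z 0 = z := fun z hz =>
    (hα z (Metric.ball_subset_closedBall hz)).1
  have hderiv : ∀ z ∈ Metric.ball x₀ R, ∀ t ∈ Ioo (-T) T, HasDerivAt (α z) (F (α z t)) t :=
    fun z hz t ht => ((hα z (Metric.ball_subset_closedBall hz)).2 t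
      (Ioo_subset_Icc_self ht)).hasDerivAt (Icc_mem_nhds ht.1 ht.2)
  refine ⟨T, hT, α, hzero, fun z hz t ht => ⟨?_, hderiv z hz t ht⟩, fun t ht =>
    (hlip t (Ioo_subset_Icc_self ht)).continuousOn.mono Metric.ball_subset_closedBall⟩
  have hdist : dist (α z t) z ≤ R := by
    have hcurve := norm_curve_sub_le (hderiv z hz) hA (abs_lt.2 ht)
    rw [hzero z hz, ← dist_eq_norm] at hcurve
    exact hcurve.trans ((mul_le_mul_of_nonneg_left (abs_lt.2 ht).le hA_nonneg).trans hAT)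
  rw [Metric.mem_ball] at hz ⊢
  linarith [dist_triangle (α z t) z x₀]

theorem exists_contDiff_eqOn_ball {E' : Type*} [NormedAddCommGroup E'] [NormedSpace ℝ E']
    [FiniteDimensional ℝ E] {n : ℕ∞} {G : E → E'} {O : Set E} (hO : IsOpen O)
    (hG : ContDiffOn ℝ n G O) {x₀ : E} (hx₀ : x₀ ∈ O) :
    ∃ R > 0, Metric.ball x₀ R ⊆ O ∧
      ∃ H : E → E', ContDiff ℝ n H ∧ HasCompactSupport H ∧ EqOn H G (Metric.ball x₀ R) := by
  obtain ⟨ρ, hρ, hρO⟩ := Metric.nhds_basis_closedBall.mem_iff.1 (hO.mem_nhds hx₀)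
  let b : ContDiffBump x₀ := ⟨ρ / 2, ρ, half_pos hρ, half_lt_self hρ⟩
  have hbO : tsupport b ⊆ O := by rwa [b.tsupport_eq]
  have hsmooth : ContDiff ℝ n fun y => b y • G y := by
    refine (contMDiff_of_tsupport fun y hy => ?_).contDiff
    exact (b.contDiffAt.smul (hG.contDiffAt (hO.mem_nhds
      (hbO (tsupport_smul_subset_left _ _ hy))))).contMDiffAt
  refine ⟨ρ / 2, half_pos hρ, (Metric.ball_subset_closedBall.trans
    (Metric.closedBall_subset_closedBall (half_le_self hρ.le))).trans hρO,
    fun y => b y • G y, hsmooth, b.hasCompactSupport.smul_right, fun y hy => ?_⟩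
  simp only [b.one_of_mem_closedBall (Metric.ball_subset_closedBall hy), one_smul]

end Euler

section Flow

variable {M : Type*} [TopologicalSpace M] [ChartedSpace Plane M] [IsManifold (𝓡 2) ∞ M]
  {F : VField M}

theorem exists_lipschitz_extension_components (hF : IsC1Field F) (c : M) :
    ∃ R > 0, Metric.ball (chartAt Plane c c) (2 * R) ⊆ (chartAt Plane c).target ∧
      ∃ (H : Plane → Plane) (K : NNReal) (A : ℝ), LipschitzWith K H ∧ (∀ y, ‖H y‖ ≤ A) ∧
        EqOn H (components c F ∘ (chartAt Plane c).symm)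
          (Metric.ball (chartAt Plane c c) (2 * R)) := by
  obtain ⟨R, hR, hball, H, hH, hHsupp, hHeq⟩ := exists_contDiff_eqOn_ball
    (chartAt Plane c).open_target ((isC1Field_iff F).1 hF c) (mem_chart_target Plane c)
  obtain ⟨K, hK⟩ := hH.lipschitzWith_of_hasCompactSupport hHsupp one_ne_zero
  obtain ⟨A, hA⟩ := hHsupp.exists_bound_of_continuous hH.continuous
  refine ⟨R / 2, half_pos hR, ?_⟩
  rw [mul_div_cancel₀ R two_ne_zero]
  exact ⟨hball, H, K, A, hK, hA, hHeq⟩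

theorem isMIntegralCurveOn_chart_symm_comp (c : M) {β : ℝ → Plane} {s : Set ℝ}
    (hβ : ∀ t ∈ s, β t ∈ (chartAt Plane c).target ∧
      HasDerivAt β (components c F ((chartAt Plane c).symm (β t))) t) :
    IsMIntegralCurveOn ((chartAt Plane c).symm ∘ β) F s := by
  intro t ht
  set e := chartAt Plane c
  obtain ⟨hmem, hderiv⟩ := hβ t ht
  have hsymm : HasMFDerivAt (𝓡 2) (𝓡 2) e.symm (β t) (mfderiv (𝓡 2) (𝓡 2) e.symm (β t)) :=
    ((mdifferentiable_chart c).mdifferentiableAt_symm hmem).hasMFDerivAt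
  have hvelocity := mfderiv_chart_symm_components c F (e.map_target hmem)
  change (mfderiv (𝓡 2) (𝓡 2) e.symm (e (e.symm (β t))) _ : Plane) = _ at hvelocity
  rw [e.right_inv hmem] at hvelocity
  refine ((hsymm.comp t hderiv.hasFDerivAt.hasMFDerivAt).congr_mfderiv ?_).hasMFDerivWithinAt
  refine ContinuousLinearMap.ext fun (r : ℝ) => ?_
  exact (map_smul (mfderiv (𝓡 2) (𝓡 2) e.symm (β t)) r _).trans
    (congrArg (fun v : Plane => r • v) hvelocity)

/-- `ψ t y`, for `y ∈ N` and `|t| < T`, is the position at time `t` of the integral curve of `F`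
issued from `y`, and depends continuously on `y`. -/
structure IsLocalFlowOn (F : VField M) (N : Set M) (T : ℝ) (ψ : ℝ → M → M) : Prop where
  apply_zero : ∀ y ∈ N, ψ 0 y = y
  isMIntegralCurveOn : ∀ y ∈ N, IsMIntegralCurveOn (fun t => ψ t y) F (Ioo (-T) T)
  continuousOn : ∀ t ∈ Ioo (-T) T, ContinuousOn (ψ t) N

omit [IsManifold (𝓡 2) ∞ M] in
theorem IsLocalFlowOn.mono {N : Set M} {T T' : ℝ} {ψ : ℝ → M → M} (h : IsLocalFlowOn F N T ψ)
    (hT' : T' ≤ T) : IsLocalFlowOn F N T' ψ where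
  apply_zero := h.apply_zero
  isMIntegralCurveOn y hy :=
    (h.isMIntegralCurveOn y hy).mono (Ioo_subset_Ioo (neg_le_neg hT') hT')
  continuousOn t ht := h.continuousOn t (Ioo_subset_Ioo (neg_le_neg hT') hT' ht)

theorem exists_isLocalFlowOn (hF : IsC1Field F) (c : M) :
    ∃ N ∈ 𝓝 c, ∃ T > 0, ∃ ψ, IsLocalFlowOn F N T ψ := by
  set e := chartAt Plane c
  obtain ⟨R, hR, hball, H, K, A, hK, hA, hH⟩ := exists_lipschitz_extension_components hF c
  obtain ⟨T, hT, α, hzero, hα, hcont⟩ := exists_local_flow hK hA (e c) hR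
  have hnhds : e.source ∩ e ⁻¹' Metric.ball (e c) R ∈ 𝓝 c :=
    (e.isOpen_inter_preimage Metric.isOpen_ball).mem_nhds
      ⟨mem_chart_source Plane c, Metric.mem_ball_self hR⟩
  refine ⟨_, hnhds, T, hT, fun t y => e.symm (α (e y) t),
    fun y hy => ?_, fun y hy => ?_, fun t ht => ?_⟩
  · rw [hzero _ hy.2, e.left_inv hy.1]
  · refine isMIntegralCurveOn_chart_symm_comp c fun t ht => ?_
    obtain ⟨hmem, hderiv⟩ := hα _ hy.2 t ht
    exact ⟨hball hmem, by rwa [hH hmem] at hderiv⟩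
  · exact e.continuousOn_symm.comp ((hcont t ht).comp (e.continuousOn.mono inter_subset_left)
      fun y hy => hy.2) fun y hy => hball (hα _ hy.2 t ht).1

theorem exists_uniform_isLocalFlowOn [CompactSpace M] (hF : IsC1Field F) :
    ∃ T > 0, ∀ c : M, ∃ N ∈ 𝓝 c, ∃ ψ, IsLocalFlowOn F N T ψ := by
  choose N hN T hT ψ hψ using fun c => exists_isLocalFlowOn hF c
  obtain ⟨s, hs⟩ := isCompact_univ.elim_nhds_subcover (fun c => interior (N c))
    fun c _ => interior_mem_nhds.2 (hN c)
  obtain ⟨T₀, hT₀, hT₀s⟩ : ∃ T₀ > 0, ∀ c ∈ s, T₀ ≤ T c := by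
    rcases s.eq_empty_or_nonempty with rfl | hne
    · exact ⟨1, one_pos, by simp⟩
    · obtain ⟨c, -, hmin⟩ := s.exists_min_image T hne
      exact ⟨T c, hT c, hmin⟩
  refine ⟨T₀, hT₀, fun x => ?_⟩
  obtain ⟨c, hc, hxc⟩ := mem_iUnion₂.1 (hs.2 (mem_univ x))
  exact ⟨N c, mem_interior_iff_mem_nhds.1 hxc, ψ c, (hψ c).mono (hT₀s c hc)⟩

variable [T2Space M]

theorem eq_of_isMIntegralCurve (hF : IsC1Field F) {γ γ' : ℝ → M}
    (hγ : IsMIntegralCurve γ F) (hγ' : IsMIntegralCurve γ' F) {t : ℝ} (h : γ t = γ' t) : γ = γ' :=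
  isMIntegralCurve_Ioo_eq_of_contMDiff_boundaryless hF hγ hγ' h

theorem eqOn_of_isMIntegralCurve (hF : IsC1Field F) {γ γ' : ℝ → M} {T : ℝ} (hT : 0 < T)
    (hγ : IsMIntegralCurveOn γ F (Ioo (-T) T)) (hγ' : IsMIntegralCurve γ' F) (h : γ 0 = γ' 0) :
    EqOn γ γ' (Ioo (-T) T) :=
  isMIntegralCurveOn_Ioo_eqOn_of_contMDiff_boundaryless ⟨neg_lt_zero.2 hT, hT⟩ hF hγ
    (hγ'.isMIntegralCurveOn _) h

theorem continuous_of_continuous_small_times {X : Type*} [TopologicalSpace X] {φ : ℝ → X → X}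
    (hzero : ∀ y, φ 0 y = y) (hadd : ∀ s t y, φ (s + t) y = φ s (φ t y)) {T : ℝ} (hT : 0 < T)
    (hsmall : ∀ t ∈ Ioo (-T) T, Continuous (φ t)) (t : ℝ) : Continuous (φ t) := by
  have hiter : ∀ (n : ℕ) s, Continuous (φ s) → Continuous (φ (n * s)) := by
    intro n s hs
    induction n with
    | zero => simpa [funext hzero] using continuous_id'
    | succ n ih =>
      have hstep : φ ((n + 1 : ℕ) * s) = φ s ∘ φ (n * s) := by
        ext y
        rw [Function.comp_apply, ← hadd, Nat.cast_succ, add_one_mul, add_comm]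
      exact hstep ▸ hs.comp ih
  obtain ⟨n, hn⟩ := exists_nat_gt (|t| / T)
  have hn_pos : (0 : ℝ) < n := (div_nonneg (abs_nonneg t) hT.le).trans_lt hn
  have hsmall_time : |t / n| < T := by
    rw [abs_div, abs_of_pos hn_pos, div_lt_iff₀ hn_pos]
    rwa [div_lt_iff₀ hT, mul_comm] at hn
  simpa [mul_div_cancel₀ t hn_pos.ne'] using hiter n _ (hsmall _ (abs_lt.1 hsmall_time))

theorem exists_flow [CompactSpace M] (hF : IsC1Field F) :
    ∃ φ : ℝ → M → M, (∀ y, φ 0 y = y) ∧ (∀ y, IsMIntegralCurve (fun t => φ t y) F) ∧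
      (∀ s t y, φ (s + t) y = φ s (φ t y)) ∧ ∀ t, Continuous (φ t) := by
  obtain ⟨T, hT, hloc⟩ := exists_uniform_isLocalFlowOn hF
  have hcurve : ∀ y : M, ∃ γ : ℝ → M, γ 0 = y ∧ IsMIntegralCurve γ F :=
    exists_isMIntegralCurve_of_isMIntegralCurveOn hF hT fun y => by
      obtain ⟨N, hN, ψ, hψ⟩ := hloc y
      exact ⟨fun t => ψ t y, hψ.apply_zero y (mem_of_mem_nhds hN),
        hψ.isMIntegralCurveOn y (mem_of_mem_nhds hN)⟩
  choose γ hzero hγ using hcurve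
  have hadd : ∀ s t y, γ y (s + t) = γ (γ y t) s := fun s t y =>
    congrFun (eq_of_isMIntegralCurve hF ((hγ y).comp_add t) (hγ (γ y t)) (t := 0)
      (by simp [hzero])) s
  refine ⟨fun t y => γ y t, hzero, hγ, hadd,
    continuous_of_continuous_small_times hzero hadd hT fun t ht => ?_⟩
  refine continuous_iff_continuousAt.2 fun c => ?_
  obtain ⟨N, hN, ψ, hψ⟩ := hloc c
  refine ((hψ.continuousOn t ht).continuousAt hN).congr ?_
  filter_upwards [hN] with y hy
  exact eqOn_of_isMIntegralCurve hF hT (hψ.isMIntegralCurveOn y hy) (hγ y)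
    (by rw [hψ.apply_zero y hy, hzero]) ht

end Flow

section Exhaustion

variable {M : Type*} [TopologicalSpace M] [ChartedSpace Plane M] {F : VField M}

/-- A set is invariant under the flow of `F` when it contains every integral curve of `F` issued
from one of its points, for positive and negative times. -/
def IsFlowInvariant (F : VField M) (S : Set M) : Prop :=
  ∀ γ : ℝ → M, IsMIntegralCurve γ F → γ 0 ∈ S → ∀ t, γ t ∈ S

theorem abs_dirDeriv_mul_le {a b : M → ℝ} {x : M} (ha : MDifferentiableAt (𝓡 2) 𝓘(ℝ, ℝ) a x)
    (hb : MDifferentiableAt (𝓡 2) 𝓘(ℝ, ℝ) b x) (ha_le : |a x| ≤ 1) (hb_le : |b x| ≤ 1) :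
    |dirDeriv (fun z => a z * b z) F x| ≤ |dirDeriv b F x| + |dirDeriv a F x| := by
  rw [dirDeriv_mul ha hb]
  refine (abs_add_le _ _).trans ?_
  rw [abs_mul, abs_mul]
  exact add_le_add (mul_le_of_le_one_left (abs_nonneg _) ha_le)
    (mul_le_of_le_one_left (abs_nonneg _) hb_le)

variable [IsManifold (𝓡 2) ∞ M]

theorem contMDiffAt_comp_chart (c : M) {χ : Plane → ℝ} (hχ : ContDiff ℝ 1 χ) {x : M}
    (hx : x ∈ (chartAt Plane c).source) :
    ContMDiffAt (𝓡 2) 𝓘(ℝ, ℝ) 1 (fun z => χ (chartAt Plane c z)) x :=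
  hχ.contMDiff.contMDiffAt.comp x
    (contMDiffOn_chart.contMDiffAt ((chartAt Plane c).open_source.mem_nhds hx))

theorem dirDeriv_comp_chart (c : M) {χ : Plane → ℝ} (hχ : ContDiff ℝ 1 χ) {x : M}
    (hx : x ∈ (chartAt Plane c).source) :
    dirDeriv (fun z => χ (chartAt Plane c z)) F x =
      fderiv ℝ χ (chartAt Plane c x) (components c F x) := by
  set e := chartAt Plane c
  have hread : (fun z => χ (e z)) ∘ e.symm =ᶠ[𝓝 (e x)] χ := by
    filter_upwards [e.open_target.mem_nhds (e.map_source hx)] with z hz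
    rw [Function.comp_apply, e.right_inv hz]
  rw [dirDeriv, mfderiv_eq_fderiv_chart c hx
    ((contMDiffAt_comp_chart c hχ hx).mdifferentiableAt one_ne_zero), hread.fderiv_eq]

theorem contMDiff_mul_comp_chart (c : M) {ψ : M → ℝ} (hψ : ContMDiff (𝓡 2) 𝓘(ℝ, ℝ) 1 ψ)
    (hψc : tsupport ψ ⊆ (chartAt Plane c).source) {χ : Plane → ℝ} (hχ : ContDiff ℝ 1 χ) :
    ContMDiff (𝓡 2) 𝓘(ℝ, ℝ) 1 fun z => ψ z * χ (chartAt Plane c z) :=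
  contMDiff_of_tsupport fun x hx =>
    (hψ x).mul (contMDiffAt_comp_chart c hχ (hψc (tsupport_mul_subset_left hx)))

omit [IsManifold (𝓡 2) ∞ M] in
theorem chart_mem_tsupport_of_mem_tsupport_mul (c : M) {ψ : M → ℝ} {χ : Plane → ℝ} {x : M}
    (hx : x ∈ tsupport fun z => ψ z * χ (chartAt Plane c z)) (hxc : x ∈ (chartAt Plane c).source) :
    chartAt Plane c x ∈ tsupport χ := by
  by_contra hnot
  refine notMem_tsupport_iff_eventuallyEq.2 ?_ (tsupport_mul_subset_right hx)
  exact ((chartAt Plane c).continuousAt hxc).eventually (notMem_tsupport_iff_eventuallyEq.1 hnot)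

variable [T2Space M] [CompactSpace M]

theorem exists_isTangentOn_chart (hF : IsC1Field F) {Ω : Set M} (hinv : IsFlowInvariant F Ωᶜ)
    (c : M) :
    ∃ R > 0, Metric.ball (chartAt Plane c c) R ⊆ (chartAt Plane c).target ∧
      ∃ (H : Plane → Plane) (K : NNReal), LipschitzWith K H ∧
        EqOn H (components c F ∘ (chartAt Plane c).symm) (Metric.ball (chartAt Plane c c) R) ∧
        IsTangentOn H ((chartAt Plane c).symm ⁻¹' Ω ∩ Metric.ball (chartAt Plane c c) R)ᶜ
          (Metric.ball (chartAt Plane c c) R) := by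
  set e := chartAt Plane c
  obtain ⟨R, hR, hball, H, K, A, hK, hA, hH⟩ := exists_lipschitz_extension_components hF c
  have hsub : Metric.ball (e c) R ⊆ Metric.ball (e c) (2 * R) :=
    Metric.ball_subset_ball (by linarith)
  obtain ⟨φ, hφzero, hφ, -⟩ := exists_flow hF
  obtain ⟨T, hT, α, hzero, hα, -⟩ := exists_local_flow hK hA (e c) hR
  refine ⟨R, hR, hsub.trans hball, H, K, hK, hH.mono hsub,
    isTangentOn_of_integral_curves hK hA hT fun z hz => ⟨α z, hzero z hz.2, fun t ht =>
      ⟨(hα z hz.2 t ht).2, fun hmem => ?_⟩⟩⟩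
  have hzΩ : e.symm z ∈ Ωᶜ := fun hzΩ => hz.1 ⟨hzΩ, hz.2⟩
  have hcurve : IsMIntegralCurveOn (e.symm ∘ α z) F (Ioo (-T) T) :=
    isMIntegralCurveOn_chart_symm_comp c fun s hs => by
      obtain ⟨hmem, hderiv⟩ := hα z hz.2 s hs
      exact ⟨hball hmem, by rwa [hH hmem] at hderiv⟩
  have heq := eqOn_of_isMIntegralCurve hF hT hcurve (hφ (e.symm z))
    (by rw [Function.comp_apply, hzero z hz.2, hφzero]) ht
  refine hinv _ (hφ (e.symm z)) (by rwa [hφzero]) t ?_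
  simp only [← heq]
  exact hmem.1

theorem exists_chart_cutoff (hF : IsC1Field F) {Ω : Set M} (hΩ : IsOpen Ω)
    (hinv : IsFlowInvariant F Ωᶜ) (c : M) :
    ∃ N ⊆ (chartAt Plane c).source, IsOpen N ∧ c ∈ N ∧
      ∃ (χ : ℕ → Plane → ℝ) (B : ℝ), (∀ n, ContDiff ℝ ∞ (χ n)) ∧ (∀ n y, χ n y ∈ Icc 0 1) ∧
        (∀ n, tsupport (χ n) ⊆ (chartAt Plane c).symm ⁻¹' Ω) ∧
        (∀ x ∈ Ω ∩ N, ∀ᶠ n in atTop, χ n =ᶠ[𝓝 (chartAt Plane c x)] fun _ => 1) ∧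
        ∀ n, ∀ x ∈ N, |dirDeriv (fun z => χ n (chartAt Plane c z)) F x| ≤ B := by
  set e := chartAt Plane c
  obtain ⟨R, hR, hball, H, K, hK, hH, htangent⟩ := exists_isTangentOn_chart hF hinv c
  have hopen : IsOpen (e.symm ⁻¹' Ω ∩ Metric.ball (e c) R) := by
    rw [← inter_eq_self_of_subset_right hball, ← inter_assoc, inter_comm (e.symm ⁻¹' Ω)]
    exact (e.isOpen_inter_preimage_symm hΩ).inter Metric.isOpen_ball
  have hne : (e.symm ⁻¹' Ω ∩ Metric.ball (e c) R)ᶜ.Nonempty := by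
    refine nonempty_compl.2 fun huniv => NormedSpace.unbounded_univ ℝ Plane ?_
    exact huniv ▸ Metric.isBounded_ball.subset inter_subset_right
  obtain ⟨χ, B, hχ, hIcc, hsupp, hone, hderiv⟩ :=
    htangent.exists_seq_cutoff hopen.isClosed_compl hne hK (half_pos hR)
  simp only [compl_compl, notMem_compl_iff] at hsupp hone
  have hball_half : Metric.ball (e c) (R / 2) ⊆ Metric.ball (e c) R :=
    Metric.ball_subset_ball (half_le_self hR.le)
  refine ⟨e.source ∩ e ⁻¹' Metric.ball (e c) (R / 2), inter_subset_left,
    e.isOpen_inter_preimage Metric.isOpen_ball,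
    ⟨mem_chart_source Plane c, Metric.mem_ball_self (half_pos hR)⟩, χ, B, hχ, hIcc,
    fun n => (hsupp n).trans inter_subset_left, fun x hx => hone _ ⟨?_, hball_half hx.2.2⟩,
    fun n x hx => ?_⟩
  · rw [mem_preimage, e.left_inv hx.2.1]
    exact hx.1
  · have hHx := hH (hball_half hx.2)
    rw [Function.comp_apply, e.left_inv hx.1] at hHx
    rw [dirDeriv_comp_chart c ((hχ n).of_le ENat.LEInfty.out) hx.1, ← hHx]
    refine hderiv n _ fun y hy => ?_
    have hyx : dist y (e x) ≤ R / 2 := hy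
    have hxc : dist (e x) (e c) < R / 2 := hx.2
    exact Metric.mem_ball.2 (by linarith [dist_triangle y (e x) (e c)])

theorem exists_local_exhaustion (hF : IsC1Field F) {Ω : Set M} (hΩ : IsOpen Ω)
    (hinv : IsFlowInvariant F Ωᶜ) (c : M) :
    ∃ N : Set M, IsOpen N ∧ c ∈ N ∧ ∀ ψ : M → ℝ, ContMDiff (𝓡 2) 𝓘(ℝ, ℝ) 1 ψ →
      (∀ x, ψ x ∈ Icc 0 1) → tsupport ψ ⊆ N →
      ∃ (a : ℕ → M → ℝ) (B : ℝ), (∀ n, ContMDiff (𝓡 2) 𝓘(ℝ, ℝ) 1 (a n)) ∧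
        (∀ n, tsupport (a n) ⊆ Ω) ∧ (∀ n x, |a n x| ≤ 1) ∧
        (∀ n x, |dirDeriv (a n) F x| ≤ B) ∧ ∀ x ∈ Ω, ∀ᶠ n in atTop, a n =ᶠ[𝓝 x] ψ := by
  obtain ⟨N, hNc, hN, hcN, χ, B, hχ, hχIcc, hχsupp, hχone, hχderiv⟩ :=
    exists_chart_cutoff hF hΩ hinv c
  refine ⟨N, hN, hcN, fun ψ hψ hψIcc hψN => ?_⟩
  set e := chartAt Plane c
  have hχ1 (n : ℕ) : ContDiff ℝ 1 (χ n) := (hχ n).of_le ENat.LEInfty.out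
  have habs {s : ℝ} (hs : s ∈ Icc (0 : ℝ) 1) : |s| ≤ 1 := (abs_of_nonneg hs.1).trans_le hs.2
  have hmul {n : ℕ} {x : M} (hx : x ∉ tsupport ψ) :
      (fun z => ψ z * χ n (e z)) =ᶠ[𝓝 x] fun _ => 0 := by
    filter_upwards [notMem_tsupport_iff_eventuallyEq.1 hx] with z hz
    rw [hz, Pi.zero_apply, zero_mul]
  obtain ⟨Bψ, hBψ⟩ := isCompact_univ.exists_bound_of_continuousOn
    (continuous_dirDeriv hF hψ).continuousOn
  have hBψ_nonneg : 0 ≤ Bψ := (norm_nonneg _).trans (hBψ c (mem_univ c))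
  have hB_nonneg : 0 ≤ B := (abs_nonneg _).trans (hχderiv 0 c hcN)
  refine ⟨fun n z => ψ z * χ n (e z), B + Bψ,
    fun n => contMDiff_mul_comp_chart c hψ (hψN.trans hNc) (hχ1 n), fun n x hx => ?_,
    fun n x => ?_, fun n x => ?_, fun x hx => ?_⟩
  · have hxc : x ∈ e.source := hNc (hψN (tsupport_mul_subset_left hx))
    have hxΩ := hχsupp n (chart_mem_tsupport_of_mem_tsupport_mul c hx hxc)
    rwa [mem_preimage, e.left_inv hxc] at hxΩ
  · rw [abs_mul]
    exact mul_le_one₀ (habs (hψIcc x)) (abs_nonneg _) (habs (hχIcc n _))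
  · by_cases hxψ : x ∈ tsupport ψ
    · have hxN := hψN hxψ
      refine (abs_dirDeriv_mul_le (hψ.mdifferentiableAt one_ne_zero)
        ((contMDiffAt_comp_chart c (hχ1 n) (hNc hxN)).mdifferentiableAt one_ne_zero)
        (habs (hψIcc x)) (habs (hχIcc n _))).trans ?_
      exact add_le_add (hχderiv n x hxN) (hBψ x (mem_univ x))
    · rw [dirDeriv_congr (hmul hxψ), dirDeriv_const, abs_zero]
      exact add_nonneg hB_nonneg hBψ_nonneg
  · by_cases hxψ : x ∈ tsupport ψ
    · filter_upwards [hχone x ⟨hx, hψN hxψ⟩] with n hn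
      filter_upwards [(e.continuousAt (hNc (hψN hxψ))).eventually hn] with z hz
      rw [hz, mul_one]
    · exact Eventually.of_forall fun n =>
        (hmul hxψ).trans (notMem_tsupport_iff_eventuallyEq.1 hxψ).symm

theorem exists_exhaustion (hF : IsC1Field F) {Ω : Set M} (hΩ : IsOpen Ω)
    (hinv : IsFlowInvariant F Ωᶜ) :
    ∃ (a : ℕ → M → ℝ) (B : ℝ), (∀ n, ContMDiff (𝓡 2) 𝓘(ℝ, ℝ) 1 (a n)) ∧
      (∀ n, tsupport (a n) ⊆ Ω) ∧ (∀ n x, |a n x| ≤ B) ∧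
      (∀ n x, |dirDeriv (a n) F x| ≤ B) ∧
      ∀ x ∈ Ω, ∀ᶠ n in atTop, a n =ᶠ[𝓝 x] fun _ => 1 := by
  choose N hN hcN hloc using exists_local_exhaustion hF hΩ hinv
  obtain ⟨s, ψ, hψ, hψIcc, hψN, hsum⟩ := exists_partition_of_unity N hN hcN
  choose a B ha hasupp habs haF hlim using fun i =>
    hloc i (ψ i) ((hψ i).of_le ENat.LEInfty.out) (hψIcc i) (hψN i)
  refine ⟨fun n x => ∑ i ∈ s, a i n x, max s.card (∑ i ∈ s, B i),
    fun n => contMDiff_finsetSum fun i _ => ha i n, fun n => ?_, fun n x => ?_, fun n x => ?_,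
    fun x hx => ?_⟩
  · have hclosed : IsClosed (⋃ i ∈ s, tsupport (a i n)) :=
      s.finite_toSet.isClosed_biUnion fun i _ => isClosed_tsupport _
    refine (closure_minimal (fun x hx => ?_) hclosed).trans (iUnion₂_subset fun i _ => hasupp i n)
    obtain ⟨i, hi, hne⟩ := Finset.exists_ne_zero_of_sum_ne_zero hx
    exact mem_biUnion (Finset.mem_coe.2 hi) (subset_tsupport _ hne)
  · refine le_max_of_le_left ((Finset.abs_sum_le_sum_abs _ _).trans ?_)
    simpa using Finset.sum_le_card_nsmul s _ 1 fun i _ => habs i n x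
  · rw [dirDeriv_sum s fun i _ => (ha i n).mdifferentiableAt one_ne_zero]
    exact le_max_of_le_right ((Finset.abs_sum_le_sum_abs _ _).trans
      (Finset.sum_le_sum fun i _ => haF i n x))
  · filter_upwards [(Filter.eventually_all_finset s).2 fun i _ => hlim i x hx] with n hn
    filter_upwards [(Filter.eventually_all_finset s).2 hn] with z hz
    rw [Finset.sum_congr rfl hz, hsum]

end Exhaustion

section Green

theorem tendsto_integral_mul_of_eventually_eq {α : Type*} [MeasurableSpace α] {μ : Measure α}
    {w b : α → ℝ} {u : ℕ → α → ℝ} {C : ℝ} (hw : Integrable w μ)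
    (hu : ∀ n, AEStronglyMeasurable (u n) μ) (hC : ∀ n x, |u n x| ≤ C)
    (hlim : ∀ᵐ x ∂μ, ∀ᶠ n in atTop, u n x = b x) :
    Tendsto (fun n => ∫ x, w x * u n x ∂μ) atTop (𝓝 (∫ x, w x * b x ∂μ)) := by
  refine tendsto_integral_of_dominated_convergence (fun x => |w x| * C)
    (fun n => hw.aestronglyMeasurable.mul (hu n)) (hw.abs.mul_const C)
    (fun n => Eventually.of_forall fun x => ?_) ?_
  · rw [Real.norm_eq_abs, abs_mul]
    exact mul_le_mul_of_nonneg_left (hC n x) (abs_nonneg _)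
  · filter_upwards [hlim] with x hx
    refine tendsto_const_nhds.congr' ?_
    filter_upwards [hx] with n hn
    rw [hn]

variable {M : Type*} [TopologicalSpace M] [ChartedSpace Plane M] [IsManifold (𝓡 2) ∞ M]
  [CompactSpace M]

theorem isTestField_smul {F : VField M} (hF : IsC1Field F) {a : M → ℝ}
    (ha : ContMDiff (𝓡 2) 𝓘(ℝ, ℝ) 1 a) {Ω : Set M} (hsupp : tsupport a ⊆ Ω) :
    IsTestField Ω (fun x => a x • F x) := by
  refine ⟨hF.smul ha, tsupport a, hsupp, (isClosed_tsupport a).isCompact, fun x hx => ?_⟩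
  simp only [image_eq_zero_of_notMem_tsupport hx]
  exact zero_smul ℝ (F x)

variable [Nonempty M] [MeasurableSpace M] [BorelSpace M]

theorem integrable_continuous_restrict [T2Space M] (g : Metric M) (Ω : Set M) {h : M → ℝ}
    (hh : Continuous h) : Integrable h ((riemannianVolume g).restrict Ω) :=
  (hh.integrable_of_hasCompactSupport (HasCompactSupport.of_compactSpace h)).restrict

theorem aestronglyMeasurable_components (g : Metric M) (Ω : Set M) (c : M) {F : VField M}
    (hF : IsC1Field F) :
    AEStronglyMeasurable (components c F)
      ((riemannianVolume g).restrict (Ω ∩ (chartAt Plane c).source)) :=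
  ((continuousOn_components c hF).aestronglyMeasurable
    (chartAt Plane c).open_source.measurableSet).mono_measure
    (Measure.restrict_mono inter_subset_right le_rfl)

theorem aestronglyMeasurable_gram (g : Metric M) (Ω : Set M) (c : M) (i j : Fin 2) :
    AEStronglyMeasurable (fun x => gram g c (chartAt Plane c x) i j)
      ((riemannianVolume g).restrict (Ω ∩ (chartAt Plane c).source)) :=
  (((contDiffOn_gram g c i j).continuousOn.comp (chartAt Plane c).continuousOn
    (chartAt Plane c).mapsTo).aestronglyMeasurable
    (chartAt Plane c).open_source.measurableSet).mono_measure
    (Measure.restrict_mono inter_subset_right le_rfl)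

theorem aestronglyMeasurable_inner (g : Metric M) {Ω : Set M} {V W : VField M}
    (hV : ∀ c : M, AEStronglyMeasurable (components c V)
      ((riemannianVolume g).restrict (Ω ∩ (chartAt Plane c).source)))
    (hW : ∀ c : M, AEStronglyMeasurable (components c W)
      ((riemannianVolume g).restrict (Ω ∩ (chartAt Plane c).source))) :
    AEStronglyMeasurable (fun x => g.inner x (V x) (W x)) ((riemannianVolume g).restrict Ω) := by
  obtain ⟨c, hc⟩ := exists_chart_cover M
  rw [← inter_univ Ω, ← hc, inter_iUnion]
  refine AEStronglyMeasurable.iUnion fun n => ?_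
  have hcoord {X : VField M} (hX : AEStronglyMeasurable (components (c n) X)
      ((riemannianVolume g).restrict (Ω ∩ (chartAt Plane (c n)).source))) (i : Fin 2) :=
    (EuclideanSpace.proj i : Plane →L[ℝ] ℝ).continuous.comp_aestronglyMeasurable hX
  have hsum := Finset.aestronglyMeasurable_fun_sum Finset.univ fun i _ =>
    (hcoord (hV (c n)) i).mul <| Finset.aestronglyMeasurable_fun_sum Finset.univ fun j _ =>
      (aestronglyMeasurable_gram g Ω (c n) i j).mul (hcoord (hW (c n)) j)
  have hsource : ∀ᵐ x ∂(riemannianVolume g).restrict (Ω ∩ (chartAt Plane (c n)).source),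
      x ∈ (chartAt Plane (c n)).source :=
    ae_mono (Measure.restrict_mono inter_subset_right le_rfl)
      (ae_restrict_mem (chartAt Plane (c n)).open_source.measurableSet)
  refine hsum.congr ?_
  filter_upwards [hsource] with x hx
  exact (inner_eq_dotProduct_gram g (c n) V W hx).symm

theorem not_ae_restrict_eq_zero (g : Metric M) {Ω : Set M} (hΩ : IsOpen Ω) {f : M → ℝ}
    (hf : ContinuousOn f Ω) (hne : ∃ x ∈ Ω, f x ≠ 0) :
    ¬ ∀ᵐ x ∂(riemannianVolume g).restrict Ω, f x = 0 := by
  intro hae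
  obtain ⟨x, hx, hfx⟩ := hne
  exact hfx (Measure.eqOn_open_of_ae_eq hae hΩ hf continuousOn_const hx)

variable [T2Space M]

theorem IsSobolev.integrable_inner {g : Metric M} {Ω : Set M} {v : M → ℝ} {V F : VField M}
    (hv : IsSobolev g Ω v V) (hF : IsC1Field F) :
    Integrable (fun x => g.inner x (V x) (F x)) ((riemannianVolume g).restrict Ω) :=
  (hv.integrable_sq.add (integrable_continuous_restrict g Ω (continuous_inner g hF hF))).mono'
    (aestronglyMeasurable_inner g hv.aestronglyMeasurable fun c =>
      aestronglyMeasurable_components g Ω c hF)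
    (Eventually.of_forall fun x => abs_inner_le g x _ _)

theorem integral_mul_divergence (g : Metric M) {f : M → ℝ} (hf : ContMDiff (𝓡 2) 𝓘(ℝ, ℝ) 1 f)
    {X : VField M} (hX : IsC1Field X) :
    ∫ x, f x * divergence g X x ∂(riemannianVolume g) =
      -∫ x, g.inner x (grad g f x) (X x) ∂(riemannianVolume g) := by
  have hdiv : ∀ x, divergence g (fun z => f z • X z) x =
      f x * divergence g X x + g.inner x (grad g f x) (X x) := fun x => by
    rw [divergence_smul g hX (hf.mdifferentiableAt one_ne_zero), inner_grad_eq_dirDeriv]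
  have hinner : Continuous fun x => g.inner x (grad g f x) (X x) := by
    simpa only [inner_grad_eq_dirDeriv] using continuous_dirDeriv hX hf
  have hmul : Continuous fun x => f x * divergence g X x :=
    hf.continuous.mul (continuous_divergence g hX)
  have hzero := integral_divergence g (hX.smul hf)
  simp only [hdiv] at hzero
  rw [integral_add (hmul.integrable_of_hasCompactSupport (HasCompactSupport.of_compactSpace _))
    (hinner.integrable_of_hasCompactSupport (HasCompactSupport.of_compactSpace _))] at hzero
  exact eq_neg_of_add_eq_zero_left hzero

theorem isSobolev_of_contMDiff (g : Metric M) (Ω : Set M) {f : M → ℝ}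
    (hf : ContMDiff (𝓡 2) 𝓘(ℝ, ℝ) 2 f) : IsSobolev g Ω f (grad g f) where
  memLp := (hf.continuous.memLp_of_hasCompactSupport
    (HasCompactSupport.of_compactSpace f)).restrict Ω
  aestronglyMeasurable c := aestronglyMeasurable_components g Ω c (isC1Field_grad g hf)
  integrable_sq := integrable_continuous_restrict g Ω
    (continuous_inner g (isC1Field_grad g hf) (isC1Field_grad g hf))
  weak_grad X := by
    rintro ⟨hX, K, hKΩ, hK, hXK⟩
    rw [setIntegral_eq_integral_of_forall_compl_eq_zero fun x hx => by
        rw [divergence_eq_zero_of_notMem g hK.isClosed hXK fun h => hx (hKΩ h), mul_zero],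
      setIntegral_eq_integral_of_forall_compl_eq_zero fun x hx => by
        rw [hXK x fun h => hx (hKΩ h), map_zero]]
    exact integral_mul_divergence g (hf.of_le one_le_two) hX

theorem IsSobolev.setIntegral_mul_divergence {g : Metric M} {Ω : Set M} (hΩ : IsOpen Ω)
    {v : M → ℝ} {V F : VField M} (hv : IsSobolev g Ω v V) (hF : IsC1Field F)
    (hinv : IsFlowInvariant F Ωᶜ) :
    ∫ x in Ω, v x * divergence g F x ∂(riemannianVolume g) =
      -∫ x in Ω, g.inner x (V x) (F x) ∂(riemannianVolume g) := by
  obtain ⟨a, B, ha, hsupp, haB, haF, hlim⟩ := exists_exhaustion hF hΩ hinv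
  obtain ⟨L, hL⟩ := isCompact_univ.exists_bound_of_continuousOn
    (continuous_divergence g hF).continuousOn
  have hdiv : ∀ n x, divergence g (fun z => a n z • F z) x =
      a n x * divergence g F x + dirDeriv (a n) F x := fun n x =>
    divergence_smul g hF ((ha n).mdifferentiableAt one_ne_zero)
  have hdiv_le : ∀ n x, |divergence g (fun z => a n z • F z) x| ≤ B * L + B := fun n x => by
    rw [hdiv]
    refine (abs_add_le _ _).trans (add_le_add ?_ (haF n x))
    rw [abs_mul]
    exact mul_le_mul (haB n x) (hL x (mem_univ x)) (abs_nonneg _)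
      ((abs_nonneg _).trans (haB n x))
  have hmem : ∀ᵐ x ∂(riemannianVolume g).restrict Ω, x ∈ Ω := ae_restrict_mem hΩ.measurableSet
  have hdiv_lim := tendsto_integral_mul_of_eventually_eq (b := divergence g F)
    (hv.memLp.integrable one_le_two)
    (fun n => (continuous_divergence g (hF.smul (ha n))).aestronglyMeasurable) hdiv_le <| by
      filter_upwards [hmem] with x hx
      filter_upwards [hlim x hx] with n hn
      rw [hdiv, dirDeriv_congr hn, dirDeriv_const, hn.eq_of_nhds, one_mul, add_zero]
  have hinner_lim := tendsto_integral_mul_of_eventually_eq (b := fun _ => 1)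
    (hv.integrable_inner hF) (fun n => (ha n).continuous.aestronglyMeasurable) haB <| by
      filter_upwards [hmem] with x hx
      filter_upwards [hlim x hx] with n hn using hn.eq_of_nhds
  simp only [mul_one] at hinner_lim
  refine tendsto_nhds_unique (hdiv_lim.congr fun n => ?_) hinner_lim.neg
  rw [hv.weak_grad _ (isTestField_smul hF (ha n) (hsupp n))]
  simp only [map_smul, smul_eq_mul, mul_comm]

theorem isNeumannEigenfunction_of_isFlowInvariant (g : Metric M) {Ω : Set M} (hΩ : IsOpen Ω)
    {f : M → ℝ} (hf : ContMDiff (𝓡 2) 𝓘(ℝ, ℝ) 2 f) {lam : ℝ}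
    (heig : ∀ x ∈ Ω, -laplaceBeltrami g f x = lam * f x)
    (hinv : IsFlowInvariant (grad g f) Ωᶜ) (hne : ∃ x ∈ Ω, f x ≠ 0) :
    IsNeumannEigenfunction g Ω f lam := by
  refine ⟨grad g f, isSobolev_of_contMDiff g Ω hf,
    not_ae_restrict_eq_zero g hΩ hf.continuous.continuousOn hne, fun v V hv => ?_⟩
  calc ∫ x in Ω, g.inner x (grad g f x) (V x) ∂(riemannianVolume g)
      = ∫ x in Ω, g.inner x (V x) (grad g f x) ∂(riemannianVolume g) := by
        simp only [g.symm _ (grad g f _)]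
    _ = -∫ x in Ω, v x * laplaceBeltrami g f x ∂(riemannianVolume g) :=
        neg_eq_iff_eq_neg.1 (hv.setIntegral_mul_divergence hΩ (isC1Field_grad g hf) hinv).symm
    _ = ∫ x in Ω, lam * (f x * v x) ∂(riemannianVolume g) := by
        rw [← integral_neg]
        refine setIntegral_congr_fun hΩ.measurableSet fun x hx => ?_
        simp only [← mul_neg, heig x hx]
        ring
    _ = lam * ∫ x in Ω, f x * v x ∂(riemannianVolume g) := integral_const_mul _ _

end Green

section InvariantSets

variable {M : Type*} [TopologicalSpace M] [ChartedSpace Plane M] {F : VField M}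

theorem isMIntegralCurve_comp_const_sub {γ : ℝ → M} (hγ : IsMIntegralCurve γ F) (t₀ : ℝ) :
    IsMIntegralCurve (fun t => γ (t₀ - t)) (fun x => -F x : VField M) := by
  convert (hγ.comp_add t₀).comp_mul (-1) using 1
  · ext t
    simp only [Function.comp_apply, mul_neg_one, neg_add_eq_sub]
  · ext x
    simp

theorem hasDerivAt_comp_isMIntegralCurve {γ : ℝ → M} (hγ : IsMIntegralCurve γ F) {u : M → ℝ}
    {t : ℝ} (hu : MDifferentiableAt (𝓡 2) 𝓘(ℝ, ℝ) u (γ t)) :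
    HasDerivAt (u ∘ γ) (dirDeriv u F (γ t)) t := by
  let l : ℝ →L[ℝ] ℝ :=
    (mfderiv (𝓡 2) 𝓘(ℝ, ℝ) u (γ t)).comp ((1 : ℝ →L[ℝ] ℝ).smulRight (F (γ t)))
  have hl : HasFDerivAt (u ∘ γ) l t := (hu.hasMFDerivAt.comp t (hγ t)).hasFDerivAt
  exact hl.hasDerivAt.congr_deriv
    (congrArg (mfderiv (𝓡 2) 𝓘(ℝ, ℝ) u (γ t)) (one_smul ℝ (F (γ t))))

theorem IsFlowInvariant.mem {S : Set M} (hS : IsFlowInvariant F S) {γ : ℝ → M}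
    (hγ : IsMIntegralCurve γ F) {s : ℝ} (hs : γ s ∈ S) (t : ℝ) : γ t ∈ S := by
  simpa using hS _ (hγ.comp_add s) (by simpa using hs) (t - s)

theorem IsFlowInvariant.compl {S : Set M} (hS : IsFlowInvariant F S) : IsFlowInvariant F Sᶜ :=
  fun _ hγ hzero _ ht => hzero (hS.mem hγ ht 0)

theorem IsFlowInvariant.inter {S T : Set M} (hS : IsFlowInvariant F S)
    (hT : IsFlowInvariant F T) : IsFlowInvariant F (S ∩ T) :=
  fun γ hγ hzero t => ⟨hS γ hγ hzero.1 t, hT γ hγ hzero.2 t⟩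

theorem IsFlowInvariant.of_neg {S : Set M}
    (hS : IsFlowInvariant (fun x => -F x : VField M) S) : IsFlowInvariant F S := by
  intro γ hγ hzero t
  simpa using hS.mem (isMIntegralCurve_comp_const_sub hγ t) (s := t) (by simpa using hzero) 0

theorem IsFlowInvariant.connectedComponentIn {S : Set M} (hS : IsFlowInvariant F S) (y : M) :
    IsFlowInvariant F (connectedComponentIn S y) := by
  intro γ hγ hzero t
  rw [connectedComponentIn_eq hzero]
  exact (isPreconnected_range hγ.continuous).subset_connectedComponentIn ⟨0, rfl⟩
    (range_subset_iff.2 (hS γ hγ (connectedComponentIn_subset S y hzero))) ⟨t, rfl⟩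

variable [IsManifold (𝓡 2) ∞ M] [T2Space M] [CompactSpace M]

theorem IsFlowInvariant.closure (hF : IsC1Field F) {S : Set M} (hS : IsFlowInvariant F S) :
    IsFlowInvariant F (closure S) := by
  intro γ hγ hzero t
  obtain ⟨φ, hφ_zero, hφ, -, hφ_cont⟩ := exists_flow hF
  have hγφ : γ = fun t => φ t (γ 0) :=
    eq_of_isMIntegralCurve hF hγ (hφ (γ 0)) (t := 0) (hφ_zero (γ 0)).symm
  rw [hγφ]
  exact map_mem_closure (hφ_cont t) hzero fun y hy =>
    hS _ (hφ y) (by rwa [hφ_zero]) t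

theorem IsFlowInvariant.frontier (hF : IsC1Field F) {S : Set M} (hS : IsFlowInvariant F S) :
    IsFlowInvariant F (frontier S) := by
  rw [frontier_eq_closure_inter_closure]
  exact (hS.closure hF).inter (hS.compl.closure hF)

end InvariantSets

section CriticalPoints

variable {M : Type*} [TopologicalSpace M] [ChartedSpace Plane M]

theorem tendsto_punctured_nhds_of_mem_source {X Y : Type*} [TopologicalSpace X]
    [TopologicalSpace Y] (e : OpenPartialHomeomorph X Y) {x : X} (hx : x ∈ e.source) :
    Tendsto e (𝓝[≠] x) (𝓝[≠] (e x)) :=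
  tendsto_nhdsWithin_of_tendsto_nhds_of_eventually_within _
    ((e.continuousAt hx).tendsto.mono_left nhdsWithin_le_nhds) (e.eventually_ne_nhdsWithin hx)

theorem punctured_nhds_neBot (p : M) : (𝓝[≠] p).NeBot := by
  have htendsto := tendsto_punctured_nhds_of_mem_source (chartAt Plane p).symm
    (mem_chart_target Plane p)
  rw [(chartAt Plane p).left_inv (mem_chart_source Plane p)] at htendsto
  exact htendsto.neBot

theorem exists_ne_zero_of_mfderiv_ne_zero {f : M → ℝ} {U : Set M} (hU : IsOpen U)
    (hne : ∃ x ∈ U, mfderiv (𝓡 2) 𝓘(ℝ, ℝ) f x ≠ 0) : ∃ x ∈ U, f x ≠ 0 := by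
  by_contra! hzero
  obtain ⟨x, hx, hfx⟩ := hne
  have hlocal : f =ᶠ[𝓝 x] fun _ => 0 := eventually_of_mem (hU.mem_nhds hx) hzero
  exact hfx (hlocal.mfderiv_eq.trans mfderiv_const)

variable [IsManifold (𝓡 2) ∞ M]

theorem mfderiv_eq_zero_iff_fderiv_chart (c : M) {f : M → ℝ} {x : M}
    (hx : x ∈ (chartAt Plane c).source) (hf : MDifferentiableAt (𝓡 2) 𝓘(ℝ, ℝ) f x) :
    mfderiv (𝓡 2) 𝓘(ℝ, ℝ) f x = 0 ↔
      fderiv ℝ (f ∘ (chartAt Plane c).symm) (chartAt Plane c x) = 0 := by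
  constructor
  · intro hzero
    ext v
    obtain ⟨X, rfl⟩ := exists_components_eq c hx v
    rw [← mfderiv_eq_fderiv_chart c hx hf X, hzero]
    rfl
  · intro hzero
    refine ContinuousLinearMap.ext fun v => ?_
    refine (mfderiv_eq_fderiv_chart c hx hf fun _ => (v : Plane)).trans ?_
    rw [hzero]
    rfl

theorem mfderiv_eq_zero_of_isLocalExtr {f : M → ℝ} {p : M} (hp : IsLocalExtr f p) :
    mfderiv (𝓡 2) 𝓘(ℝ, ℝ) f p = 0 := by
  by_cases hf : MDifferentiableAt (𝓡 2) 𝓘(ℝ, ℝ) f p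
  · have htendsto := (chartAt Plane p).continuousAt_symm (mem_chart_target Plane p)
    rw [← (chartAt Plane p).left_inv (mem_chart_source Plane p)] at hp
    rw [mfderiv_eq_zero_iff_fderiv_chart p (mem_chart_source Plane p) hf]
    have hextr : IsLocalExtr (f ∘ (chartAt Plane p).symm) (chartAt Plane p p) :=
      hp.imp (·.comp_tendsto htendsto) (·.comp_tendsto htendsto)
    exact hextr.fderiv_eq_zero
  · exact mfderiv_zero_of_not_mdifferentiableAt hf

theorem IsMorse.eventually_mfderiv_ne_zero {f : M → ℝ} (hf : IsMorse f) {p : M}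
    (hp : mfderiv (𝓡 2) 𝓘(ℝ, ℝ) f p = 0) :
    ∀ᶠ x in 𝓝[≠] p, mfderiv (𝓡 2) 𝓘(ℝ, ℝ) f x ≠ 0 := by
  set e := chartAt Plane p
  have hp_source : p ∈ e.source := mem_chart_source Plane p
  have hchart : ContDiffAt ℝ ∞ (f ∘ e.symm) (e p) :=
    ((contMDiffOn_iff_contDiffOn_chart p f).1 hf.smooth.contMDiffOn).contDiffAt
      (e.open_target.mem_nhds (mem_chart_target Plane p))
  have hhessian : HasFDerivAt (fderiv ℝ (f ∘ e.symm)) (hessian f p) (e p) :=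
    ((hchart.fderiv_right (m := 1)
      (one_add_one_eq_two.trans_le ENat.LEInfty.out)).differentiableAt one_ne_zero).hasFDerivAt
  have hker : LinearMap.ker (hessian f p : Plane →ₗ[ℝ] (Plane →L[ℝ] ℝ)) = ⊥ :=
    LinearMap.ker_eq_bot'.2 fun v hv =>
      hf.nondegenerate p hp v fun w => congrArg (fun l : Plane →L[ℝ] ℝ => l w) hv
  obtain ⟨K, -, hK⟩ := LinearMap.exists_antilipschitzWith _ hker
  have hne := hhessian.eventually_ne (c := 0) ⟨K, hK⟩
  filter_upwards [(tendsto_punctured_nhds_of_mem_source e hp_source).eventually hne,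
    mem_nhdsWithin_of_mem_nhds (e.open_source.mem_nhds hp_source)] with x hx hx_source
  rwa [Ne, mfderiv_eq_zero_iff_fderiv_chart p hx_source
    (hf.smooth.mdifferentiableAt (by norm_num))]

theorem eq_of_forall_inner_eq (g : Metric M) {x : M} {v w : TangentSpace (𝓡 2) x}
    (h : ∀ z, g.inner x v z = g.inner x w z) : v = w := by
  by_contra hne
  refine (g.pos x (v - w) (sub_ne_zero.2 hne)).ne' ?_
  have hdiff : g.inner x (v - w) = 0 := by
    ext z
    rw [map_sub, sub_apply, h, sub_self]
    rfl
  rw [hdiff]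
  rfl

theorem grad_neg (g : Metric M) (f : M → ℝ) : grad g (-f) = fun x => -grad g f x := by
  funext x
  refine eq_of_forall_inner_eq g fun w => ?_
  rw [map_neg, neg_apply, inner_grad, inner_grad, mfderiv_neg]
  rfl

theorem grad_eq_zero_iff (g : Metric M) {f : M → ℝ} {x : M} :
    grad g f x = 0 ↔ mfderiv (𝓡 2) 𝓘(ℝ, ℝ) f x = 0 := by
  refine ⟨fun h => ContinuousLinearMap.ext fun w => ?_,
    fun h => eq_of_forall_inner_eq g fun w => ?_⟩
  · rw [← inner_grad, h, map_zero]
    rfl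
  · rw [inner_grad, h, map_zero]
    rfl

end CriticalPoints

section StableManifold

theorem eventually_lt_of_isLocalMin {X : Type*} [TopologicalSpace X] {f : X → ℝ} {p : X}
    (hp : IsLocalMin f p) (hiso : ∀ᶠ x in 𝓝[≠] p, ¬IsLocalMin f x) :
    ∀ᶠ x in 𝓝[≠] p, f p < f x := by
  rw [eventually_nhdsWithin_iff] at hiso ⊢
  filter_upwards [hp.eventually_nhds, hiso] with x hx hiso_x hxp
  refine lt_of_le_of_ne hx.self_of_nhds fun heq => hiso_x hxp ?_
  filter_upwards [hx] with z hz
  rwa [← heq]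

theorem mapsTo_interior_of_notMem_frontier {X : Type*} [TopologicalSpace X] {γ : ℝ → X}
    {B : Set X} {a : ℝ} (hγ : Continuous γ) (hB : IsClosed B) (hmem : γ a ∈ interior B)
    (hfrontier : ∀ t, a ≤ t → γ t ∉ frontier B) : MapsTo γ (Ici a) (interior B) := by
  rw [mapsTo_iff_image_subset]
  refine (isPreconnected_Ici.image γ hγ.continuousOn).subset_left_of_subset_union
    isOpen_interior hB.isOpen_compl (disjoint_compl_right.mono_left interior_subset) ?_
    ⟨γ a, ⟨a, self_mem_Ici, rfl⟩, hmem⟩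
  rintro _ ⟨t, ht, rfl⟩
  by_contra hnot
  rw [mem_union, not_or, notMem_compl_iff] at hnot
  exact hfrontier t ht (hB.frontier_eq ▸ ⟨hnot.2, hnot.1⟩)

theorem exists_lt_of_hasDerivAt_le {u u' : ℝ → ℝ} {ε : ℝ} (hε : 0 < ε)
    (hu : ∀ t, 0 ≤ t → HasDerivAt u (u' t) t) (hle : ∀ t, 0 ≤ t → u' t ≤ -ε) (m : ℝ) :
    ∃ t, 0 ≤ t ∧ u t < m := by
  have hdecay : ∀ t, 0 ≤ t → u t - u 0 ≤ -ε * (t - 0) := by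
    intro t ht
    refine (convex_Ici (0 : ℝ)).image_sub_le_mul_sub_of_deriv_le
      (fun s hs => (hu s hs).continuousAt.continuousWithinAt)
      (fun s hs => (hu s (interior_subset hs)).differentiableAt.differentiableWithinAt)
      (fun s hs => ?_) 0 self_mem_Ici t ht ht
    rw [(hu s (interior_subset hs)).deriv]
    exact hle s (interior_subset hs)
  have hlim : Tendsto (fun t => u 0 + -ε * (t - 0)) atTop atBot :=
    tendsto_atBot_add_const_left _ _
      ((tendsto_id.atTop_add tendsto_const_nhds).const_mul_atTop_of_neg (neg_lt_zero.2 hε))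
  obtain ⟨t, hlt, ht⟩ := ((hlim.eventually_lt_atBot m).and (eventually_ge_atTop 0)).exists
  exact ⟨t, ht, by linarith [hdecay t ht]⟩

variable {M : Type*} [TopologicalSpace M] [ChartedSpace Plane M] [IsManifold (𝓡 2) ∞ M]

section Decrease

variable (g : Metric M) {f : M → ℝ} {γ : ℝ → M}

theorem hasDerivAt_comp_of_isMIntegralCurve_neg_grad {t : ℝ}
    (hf : MDifferentiableAt (𝓡 2) 𝓘(ℝ, ℝ) f (γ t))
    (hγ : IsMIntegralCurve γ (fun x => -grad g f x : VField M)) :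
    HasDerivAt (f ∘ γ) (-g.inner (γ t) (grad g f (γ t)) (grad g f (γ t))) t := by
  rw [inner_grad]
  exact (hasDerivAt_comp_isMIntegralCurve hγ hf).congr_deriv
    (map_neg (mfderiv (𝓡 2) 𝓘(ℝ, ℝ) f (γ t)) (grad g f (γ t)))

theorem antitone_comp_of_isMIntegralCurve_neg_grad (hf : MDifferentiable (𝓡 2) 𝓘(ℝ, ℝ) f)
    (hγ : IsMIntegralCurve γ (fun x => -grad g f x : VField M)) : Antitone (f ∘ γ) :=
  antitone_of_hasDerivAt_nonpos
    (fun t => hasDerivAt_comp_of_isMIntegralCurve_neg_grad g (hf (γ t)) hγ)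
    fun _ => neg_nonpos.2 (inner_self_nonneg g _ _)

theorem exists_lt_of_mapsTo_isCompact (hf : ContMDiff (𝓡 2) 𝓘(ℝ, ℝ) 2 f)
    (hγ : IsMIntegralCurve γ (fun x => -grad g f x : VField M)) {B : Set M} (hB : IsCompact B)
    (hmem : MapsTo γ (Ici 0) B) {m : ℝ}
    (hcritical : ∀ x ∈ B, m ≤ f x → mfderiv (𝓡 2) 𝓘(ℝ, ℝ) f x ≠ 0) :
    ∃ t, 0 ≤ t ∧ f (γ t) < m := by
  by_contra! hnot
  have hgrad := isC1Field_grad g hf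
  obtain ⟨ε, hε, hle⟩ := (hB.inter_right (isClosed_Ici.preimage hf.continuous)).exists_forall_le'
    (continuous_inner g hgrad hgrad).continuousOn (a := 0) fun x hx =>
      g.pos x _ (mt (grad_eq_zero_iff g).1 (hcritical x hx.1 hx.2))
  obtain ⟨t, ht, hlt⟩ := exists_lt_of_hasDerivAt_le hε
    (fun t _ => hasDerivAt_comp_of_isMIntegralCurve_neg_grad g
      (hf.mdifferentiableAt two_ne_zero) hγ)
    (fun t ht => neg_le_neg (hle _ ⟨hmem ht, hnot t ht⟩)) m
  exact (hnot t ht).not_gt hlt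

theorem tendsto_of_mapsTo_isCompact (hf : ContMDiff (𝓡 2) 𝓘(ℝ, ℝ) 2 f)
    (hγ : IsMIntegralCurve γ (fun x => -grad g f x : VField M)) {B : Set M} (hB : IsCompact B)
    (hmem : MapsTo γ (Ici 0) B) {p : M}
    (hp : ∀ x ∈ B, x ≠ p → f p < f x ∧ mfderiv (𝓡 2) 𝓘(ℝ, ℝ) f x ≠ 0) :
    Tendsto γ atTop (𝓝 p) := by
  refine tendsto_nhds.2 fun U hU hpU => ?_
  obtain ⟨m, hpm, hm⟩ := (hB.diff hU).exists_forall_le' hf.continuous.continuousOn (a := f p)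
    fun x hx => (hp x hx.1 (ne_of_mem_of_not_mem hpU hx.2).symm).1
  obtain ⟨t₀, ht₀, hlt⟩ := exists_lt_of_mapsTo_isCompact g hf hγ hB hmem (m := m)
    fun x hx hmx => (hp x hx fun hxp => (hxp ▸ hmx).not_gt hpm).2
  filter_upwards [eventually_ge_atTop t₀] with t ht
  by_contra hnot
  have hanti := antitone_comp_of_isMIntegralCurve_neg_grad g
    (hf.mdifferentiable two_ne_zero) hγ ht
  exact (hm (γ t) ⟨hmem (ht₀.trans ht), hnot⟩).not_gt (hanti.trans_lt hlt)

theorem exists_forall_tendsto_of_isLocalMin [LocallyCompactSpace M] [T2Space M]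
    (hf : ContMDiff (𝓡 2) 𝓘(ℝ, ℝ) 2 f) {p : M} (hp : IsLocalMin f p)
    (hiso : ∀ᶠ x in 𝓝[≠] p, mfderiv (𝓡 2) 𝓘(ℝ, ℝ) f x ≠ 0) :
    ∃ N : Set M, IsOpen N ∧ p ∈ N ∧ ∀ γ : ℝ → M,
      IsMIntegralCurve γ (fun x => -grad g f x : VField M) → γ 0 ∈ N → Tendsto γ atTop (𝓝 p) := by
  have hlt := eventually_lt_of_isLocalMin hp
    (hiso.mono fun x hx hmin => hx (mfderiv_eq_zero_of_isLocalExtr (Or.inl hmin)))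
  obtain ⟨O, hOsub, hO, hpO⟩ :=
    mem_nhds_iff.1 (eventually_nhdsWithin_iff.1 (hlt.and hiso))
  obtain ⟨B, hB, hpB, hBO⟩ := exists_compact_subset hO hpO
  obtain ⟨m, hpm, hm⟩ := (hB.diff isOpen_interior).exists_forall_le'
    hf.continuous.continuousOn (a := f p)
    fun x hx => (hOsub (hBO hx.1) (ne_of_mem_of_not_mem hpB hx.2).symm).1
  refine ⟨interior B ∩ f ⁻¹' Iio m, isOpen_interior.inter (isOpen_Iio.preimage hf.continuous),
    ⟨hpB, hpm⟩, fun γ hγ hmem => ?_⟩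
  have hanti := antitone_comp_of_isMIntegralCurve_neg_grad g (hf.mdifferentiable two_ne_zero) hγ
  have hstay : MapsTo γ (Ici 0) (interior B) :=
    mapsTo_interior_of_notMem_frontier hγ.continuous hB.isClosed hmem.1 fun t ht hfrontier =>
      (hm (γ t) (hB.isClosed.frontier_eq ▸ hfrontier)).not_gt ((hanti ht).trans_lt hmem.2)
  exact tendsto_of_mapsTo_isCompact g hf hγ hB (hstay.mono_right interior_subset)
    fun x hx => hOsub (hBO hx)

end Decrease

theorem unstableManifold_eq (g : Metric M) (f : M → ℝ) (q : M) :
    unstableManifold g f q = stableManifold g (-f) q := by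
  ext y
  constructor
  · rintro ⟨γ, ⟨hzero, hγ⟩, hlim⟩
    refine ⟨fun t => γ (0 - t), ⟨by simpa using hzero, ?_⟩, by simpa using hlim⟩
    rw [grad_neg]
    exact isMIntegralCurve_comp_const_sub hγ 0
  · rintro ⟨γ, ⟨hzero, hγ⟩, hlim⟩
    refine ⟨fun t => γ (0 - t), ⟨by simpa using hzero, ?_⟩, by simpa using hlim⟩
    simpa only [grad_neg, neg_neg] using isMIntegralCurve_comp_const_sub hγ 0

theorem isC1Field_neg_grad (g : Metric M) {f : M → ℝ} (hf : ContMDiff (𝓡 2) 𝓘(ℝ, ℝ) 2 f) :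
    IsC1Field (fun x => -grad g f x) := by
  rw [← grad_neg]
  exact isC1Field_grad g hf.neg

variable [T2Space M]

theorem tendsto_of_mem_stableManifold (g : Metric M) {f : M → ℝ}
    (hf : ContMDiff (𝓡 2) 𝓘(ℝ, ℝ) 2 f) {p : M} {γ : ℝ → M}
    (hγ : IsMIntegralCurve γ (fun x => -grad g f x : VField M)) {s : ℝ}
    (hs : γ s ∈ stableManifold g f p) : Tendsto γ atTop (𝓝 p) := by
  obtain ⟨γ', ⟨hzero, hγ'⟩, hlim⟩ := hs
  have heq : γ' = γ ∘ (· + s) :=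
    eq_of_isMIntegralCurve (isC1Field_neg_grad g hf) hγ' (hγ.comp_add s) (t := 0) (by simp [hzero])
  refine (hlim.comp (tendsto_atTop_add_const_right atTop (-s) tendsto_id)).congr fun t => ?_
  simp [heq]

theorem isFlowInvariant_stableManifold (g : Metric M) {f : M → ℝ}
    (hf : ContMDiff (𝓡 2) 𝓘(ℝ, ℝ) 2 f) (p : M) :
    IsFlowInvariant (grad g f) (stableManifold g f p) := by
  refine IsFlowInvariant.of_neg fun γ hγ hzero t => ?_
  refine ⟨γ ∘ (· + t), ⟨by simp, hγ.comp_add t⟩, ?_⟩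
  exact (tendsto_of_mem_stableManifold g hf hγ hzero).comp
    (tendsto_atTop_add_const_right atTop t tendsto_id)

theorem isFlowInvariant_unstableManifold (g : Metric M) {f : M → ℝ}
    (hf : ContMDiff (𝓡 2) 𝓘(ℝ, ℝ) 2 f) (q : M) :
    IsFlowInvariant (grad g f) (unstableManifold g f q) := by
  rw [unstableManifold_eq]
  refine IsFlowInvariant.of_neg ?_
  rw [← grad_neg]
  exact isFlowInvariant_stableManifold g hf.neg q

theorem eq_of_mem_stableManifold_of_mfderiv_eq_zero (g : Metric M) {f : M → ℝ}
    (hf : ContMDiff (𝓡 2) 𝓘(ℝ, ℝ) 2 f) {p x : M} (hx : x ∈ stableManifold g f p)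
    (hcritical : mfderiv (𝓡 2) 𝓘(ℝ, ℝ) f x = 0) : x = p := by
  have hconst : IsMIntegralCurve (fun _ => x) (fun x => -grad g f x : VField M) :=
    isMIntegralCurve_const (by rw [(grad_eq_zero_iff g).2 hcritical, neg_zero])
  exact tendsto_nhds_unique tendsto_const_nhds
    (tendsto_of_mem_stableManifold g hf hconst (s := 0) hx)

theorem exists_mfderiv_ne_zero_of_subset_stableManifold (g : Metric M) {f : M → ℝ}
    (hf : ContMDiff (𝓡 2) 𝓘(ℝ, ℝ) 2 f) {p : M}
    {U : Set M} (hU : IsOpen U) (hne : U.Nonempty) (hsub : U ⊆ stableManifold g f p) :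
    ∃ x ∈ U, mfderiv (𝓡 2) 𝓘(ℝ, ℝ) f x ≠ 0 := by
  by_contra! hcritical
  have heq : ∀ x ∈ U, x = p := fun x hx =>
    eq_of_mem_stableManifold_of_mfderiv_eq_zero g hf (hsub hx) (hcritical x hx)
  obtain ⟨x, hx⟩ := hne
  have hpU : U ∈ 𝓝 p := hU.mem_nhds (heq x hx ▸ hx)
  have := punctured_nhds_neBot p
  obtain ⟨y, hy, hyp⟩ :=
    (Eventually.and (mem_nhdsWithin_of_mem_nhds hpU) (self_mem_nhdsWithin (s := {p}ᶜ))).exists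
  exact hyp (heq y hy)

theorem isOpen_stableManifold [CompactSpace M] (g : Metric M) {f : M → ℝ}
    (hf : ContMDiff (𝓡 2) 𝓘(ℝ, ℝ) 2 f) {p : M} (hp : IsLocalMin f p)
    (hiso : ∀ᶠ x in 𝓝[≠] p, mfderiv (𝓡 2) 𝓘(ℝ, ℝ) f x ≠ 0) :
    IsOpen (stableManifold g f p) := by
  obtain ⟨N, hN, hpN, htendsto⟩ := exists_forall_tendsto_of_isLocalMin g hf hp hiso
  obtain ⟨φ, hφ_zero, hφ, -, hφ_cont⟩ := exists_flow (isC1Field_neg_grad g hf)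
  have hunion : stableManifold g f p = ⋃ T, φ T ⁻¹' N := by
    ext y
    rw [mem_iUnion]
    constructor
    · intro hy
      have hlim := tendsto_of_mem_stableManifold g hf (hφ y) (s := 0) (by rwa [hφ_zero])
      exact (hlim.eventually (hN.mem_nhds hpN)).exists
    · rintro ⟨T, hT⟩
      refine ⟨fun t => φ t y, ⟨hφ_zero y, hφ y⟩, ?_⟩
      have hlim := htendsto _ ((hφ y).comp_add T) (by simpa using hT)
      simpa [Function.comp_def] using
        hlim.comp (tendsto_atTop_add_const_right atTop (-T) tendsto_id)
  rw [hunion]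
  exact isOpen_iUnion fun T => hN.preimage (hφ_cont T)

end StableManifold

section NeumannDomain

variable {M : Type*} [TopologicalSpace M] [ChartedSpace Plane M] [IsManifold (𝓡 2) ∞ M] [T2Space M]
  {g : Metric M} {f : M → ℝ} {Ω : Set M}

theorem IsNeumannDomain.isFlowInvariant (hΩ : IsNeumannDomain g f Ω)
    (hf : ContMDiff (𝓡 2) 𝓘(ℝ, ℝ) 2 f) : IsFlowInvariant (grad g f) Ω := by
  obtain ⟨p, q, -, -, y, -, rfl⟩ := hΩ
  exact ((isFlowInvariant_stableManifold g hf p).inter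
    (isFlowInvariant_unstableManifold g hf q)).connectedComponentIn y

variable [CompactSpace M]

theorem IsNeumannDomain.isOpen (hΩ : IsNeumannDomain g f Ω) (hf : ContMDiff (𝓡 2) 𝓘(ℝ, ℝ) 2 f)
    (hiso : ∀ p, IsLocalExtr f p → ∀ᶠ x in 𝓝[≠] p, mfderiv (𝓡 2) 𝓘(ℝ, ℝ) f x ≠ 0) :
    IsOpen Ω := by
  obtain ⟨p, q, hp, hq, y, -, rfl⟩ := hΩ
  have : LocallyConnectedSpace M := ChartedSpace.locallyConnectedSpace Plane M
  refine ((isOpen_stableManifold g hf hp (hiso p (Or.inl hp))).inter ?_).connectedComponentIn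
  rw [unstableManifold_eq]
  exact isOpen_stableManifold g (f := -f) hf.neg hq.neg
    ((hiso q (Or.inr hq)).mono fun x hx => by
      rwa [Ne, ← grad_eq_zero_iff g, grad_neg, neg_eq_zero, grad_eq_zero_iff])

theorem IsNeumannDomain.exists_ne_zero (hΩ : IsNeumannDomain g f Ω)
    (hf : ContMDiff (𝓡 2) 𝓘(ℝ, ℝ) 2 f)
    (hiso : ∀ p, IsLocalExtr f p → ∀ᶠ x in 𝓝[≠] p, mfderiv (𝓡 2) 𝓘(ℝ, ℝ) f x ≠ 0) :
    ∃ x ∈ Ω, f x ≠ 0 := by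
  have hopen := hΩ.isOpen hf hiso
  obtain ⟨p, q, -, -, y, hy, rfl⟩ := hΩ
  exact exists_ne_zero_of_mfderiv_ne_zero hopen
    (exists_mfderiv_ne_zero_of_subset_stableManifold g hf hopen
      ⟨y, mem_connectedComponentIn hy⟩
      ((connectedComponentIn_subset _ _).trans inter_subset_left))

theorem normalDerivativeVanishes_of_isFlowInvariant (hf : ContMDiff (𝓡 2) 𝓘(ℝ, ℝ) 2 f)
    (hΩ : IsFlowInvariant (grad g f) Ω) : NormalDerivativeVanishes g Ω f := by
  intro x hx h hh hh_zero
  have hF := isC1Field_grad g hf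
  obtain ⟨φ, hφ_zero, hφ, -⟩ := exists_flow hF
  have hcurve_zero : φ 0 x = x := hφ_zero x
  have hcurve : Tendsto (fun t => φ t x) (𝓝 0) (𝓝[frontier Ω] x) := by
    refine tendsto_nhdsWithin_iff.2 ⟨?_, Eventually.of_forall
      (hΩ.frontier hF _ (hφ x) (by rwa [hcurve_zero]))⟩
    simpa only [hcurve_zero] using (hφ x).continuous.tendsto 0
  have hlocal : h ∘ (fun t => φ t x) =ᶠ[𝓝 0] fun _ => 0 := hcurve.eventually hh_zero
  have hderiv := hasDerivAt_comp_isMIntegralCurve (hφ x) (t := 0) (by rwa [hcurve_zero])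
  have hdir := (hderiv.congr_of_eventuallyEq hlocal.symm).unique (hasDerivAt_const 0 0)
  rwa [hcurve_zero, ← inner_grad_eq_dirDeriv g] at hdir

end NeumannDomain

end NeumannDomains

open NeumannDomains in
theorem mainTheorem7_general {M : Type*} [TopologicalSpace M] [ChartedSpace Plane M]
    [IsManifold (𝓡 2) ∞ M] [T2Space M] [CompactSpace M] [Nonempty M]
    [MeasurableSpace M] [BorelSpace M]
    (g : Metric M) (f : M → ℝ) (lam : ℝ) (hf : ContMDiff (𝓡 2) 𝓘(ℝ, ℝ) 2 f)
    (hiso : ∀ p, IsLocalExtr f p → ∀ᶠ x in 𝓝[≠] p, mfderiv (𝓡 2) 𝓘(ℝ, ℝ) f x ≠ 0)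
    (Ω : Set M) (hΩ : IsNeumannDomain g f Ω)
    (heig : ∀ x ∈ Ω, -laplaceBeltrami g f x = lam * f x) :
    IsNeumannEigenfunction g Ω f lam ∧ NormalDerivativeVanishes g Ω f :=
  have hinv := hΩ.isFlowInvariant hf
  ⟨isNeumannEigenfunction_of_isFlowInvariant g (hΩ.isOpen hf hiso) hf heig hinv.compl
    (hΩ.exists_ne_zero hf hiso), normalDerivativeVanishes_of_isFlowInvariant hf hinv⟩

open NeumannDomains in
theorem mainTheorem7 {M : Type*} [TopologicalSpace M] [ChartedSpace Plane M]
    [IsManifold (𝓡 2) ∞ M] [T2Space M] [CompactSpace M] [ConnectedSpace M]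
    [MeasurableSpace M] [BorelSpace M]
    (g : Metric M) (f : M → ℝ) (lam : ℝ)
    (hf : IsMorse f) (heig : IsLaplaceEigenfunction g f lam)
    (Ω : Set M) (hΩ : IsNeumannDomain g f Ω) :
    IsNeumannEigenfunction g Ω f lam ∧ NormalDerivativeVanishes g Ω f :=
  mainTheorem7_general g f lam (hf.smooth.of_le ENat.LEInfty.out)
    (fun _ hp => hf.eventually_mfderiv_ne_zero (mfderiv_eq_zero_of_isLocalExtr hp)) Ω hΩ
    fun x _ => heig.eigen x
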